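/- A \emph{weight matrix} is a family $\mathcal M=\{\mathbb M^{(p)}:p>0\}$ of sequences $\mathbb M^{(p)}=(M^{(p)}_j)_{j\in\mathbb N_0}$ of positive real numbers, indexed by the real numbers $p>0$, with $M^{(p)}_0=1$ for all $p$ and $M^{(p)}_j\le M^{(q)}_j$ for all $j$ whenever $p\le q$. Write $\check M_j:=M_j/j!$ and use the convention $0^0:=1$. A positive sequence $\mathbb L$ is log-convex if $L_j^2\le L_{j-1}L_{j+1}$ for all $j\ge1$, and $\mathbb N^{\mathrm{lc}}$ denotes the largest log-convex sequence lying pointwise below $\mathbb N$. For $0<\alpha\le1$ let $S_\alpha=\{z\in\mathbb C\setminus\{0\}:|\arg z|<\alpha\pi/2\}$. Let $\mathcal A_{\{\mathcal M\}}(S_\alpha)$ be the set of all holomorphic $f$ on $S_\alpha$ for which there are $p>0$, $h>0$ with $\sup_{z\in S_\alpha,\,j\in\mathbb N_0}|f^{(j)}(z)|/(h^jM^{(p)}_j)<\infty$. For $U\subseteq\mathbb C$ open let $\mathcal H(U)$ be the set of holomorphic functions on $U$, and $\mathcal H_{\{\mathcal M\}}(U)$ the set of all $g\in\mathcal H(U)$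 such that for every compact $K\subset U$ there are $p>0$, $h>0$ with $\sup_{z\in K,\,j\in\mathbb N_0}|g^{(j)}(z)|/(h^jM^{(p)}_j)<\infty$. The class $\mathcal A_{\{\mathcal M\}}(S_\alpha)$ is called - \emph{holomorphically closed} if $g\circ f\in\mathcal A_{\{\mathcal M\}}(S_\alpha)$ for all $f\in\mathcal A_{\{\mathcal M\}}(S_\alpha)$, all open $U\supseteq\overline{f(S_\alpha)}$ and all $g\in\mathcal H(U)$; - \emph{inverse-closed} if $1/f\in\mathcal A_{\{\mathcal M\}}(S_\alpha)$ for all $f\in\mathcal A_{\{\mathcal M\}}(S_\alpha)$ with $\inf_{z\in S_\alpha}|f(z)|>0$; - \emph{closed under composition} if $g\circ f\in\mathcal A_{\{\mathcal M\}}(S_\alpha)$ for all $f\in\mathcal A_{\{\mathcal M\}}(S_\alpha)$, all open $U\supseteq\overline{f(S_\alpha)}$ and all $g\in\mathcal H_{\{\mathcal M\}}(U)$. For a weight matrix $\mathcal M$ consider the conditions - $(\mathcal M_{\{\mathrm{rai}\}})$: for every $p>0$ there are $C>0$, $q>0$ with $(\check M^{(p)}_j)^{1/j}\le C(\check M^{(q)}_k)^{1/k}$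 for all $1\le j\le k$; - $(\mathcal M_{\{\mathrm{FdB}\}})$: for every $p>0$ there are $q>0$, $A>0$, $B>0$ with $(\check M^{(p)})^\circ_k\le AB^k\check M^{(q)}_k$ for all $k\in\mathbb N_0$, where $(\check M^{(p)})^\circ_0:=1$ and, for $k\ge1$, $(\check M^{(p)})^\circ_k:=\max\{\check M^{(p)}_\ell\check M^{(p)}_{j_1}\cdots\check M^{(p)}_{j_\ell}:\ \ell\ge1,\ j_i\ge1,\ j_1+\dots+j_\ell=k\}$; - $(\mathcal M_{\{\mathrm{dc}\}})$: for every $p>0$ there are $C>0$, $q>0$ with $M^{(p)}_{j+1}\le C^{j+1}M^{(q)}_j$ for all $j\in\mathbb N_0$; - $(\mathcal M_{\{\mathrm C^\omega\}})$: there is $p>0$ with $\liminf_{j\to\infty}(\check M^{(p)}_j)^{1/j}>0$. \textbf{Theorem.} Let $\mathcal M$ be a weight matrix and $0<\alpha\le1$ be such that $\lim_{j\to\infty}(j^{(1-\alpha)j}M^{(p)}_j)^{1/j}=\infty$ for every $p>0$. Let $\mathcal M^\alpha=\{\mathbb M^{(p,\alpha)}:p>0\}$ be the weight matrix given by $M^{(p,\alpha)}_j:=j^{(\alpha-1)j}\,\big((i^{(1-\alpha)i}M^{(p)}_i)_{i\in\mathbb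 N_0}\big)^{\mathrm{lc}}_j$. Then the following are equivalent: (a) $\mathcal M^\alpha$ satisfies $(\mathcal M_{\{\mathrm{rai}\}})$; (b) $\mathcal A_{\{\mathcal M\}}(S_\alpha)$ is holomorphically closed; (c) $\mathcal A_{\{\mathcal M\}}(S_\alpha)$ is inverse-closed. If in addition $\mathcal M$ satisfies $(\mathcal M_{\{\mathrm C^\omega\}})$ and $\mathcal M^\alpha$ satisfies $(\mathcal M_{\{\mathrm{dc}\}})$, then (a), (b), (c) are also equivalent to each of: (d) $\mathcal A_{\{\mathcal M\}}(S_\alpha)$ is closed under composition; (e) $\mathcal M^\alpha$ satisfies $(\mathcal M_{\{\mathrm{FdB}\}})$. -/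

import Mathlib

open Filter Topology

noncomputable section

namespace Ultraholomorphic

/-- A one-parameter family of real sequences `(M^(p)_j)`, indexed by real `p > 0` and `j ∈ ℕ₀`. -/
abbrev SeqFamily : Type := Set.Ioi (0 : ℝ) → ℕ → ℝ

/-- Weight matrices: positive sequences, with `M^(p)_0 = 1`, pointwise nondecreasing in `p`. -/
structure IsWeightMatrix (M : SeqFamily) : Prop where
  pos : ∀ p j, 0 < M p j
  zero : ∀ p, M p 0 = 1
  mono : ∀ p q, p ≤ q → ∀ j, M p j ≤ M q j

/-- The sequence `M̌_j = M_j / j!`. -/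
def check (M : ℕ → ℝ) (j : ℕ) : ℝ := M j / (Nat.factorial j : ℝ)

/-- The Gevrey-like sequence `j ^ (j s)`, with the convention `0 ^ 0 = 1`. -/
def gevreyBar (s : ℝ) (j : ℕ) : ℝ := (j : ℝ) ^ (s * (j : ℝ))

/-- Log-convexity: `M_j ^ 2 ≤ M_{j-1} M_{j+1}` for all `j ≥ 1`. -/
def LogConvex (M : ℕ → ℝ) : Prop := ∀ j, M (j + 1) ^ 2 ≤ M j * M (j + 2)

/-- The log-convex minorant of a sequence: the pointwise largest among the positive log-convex
sequences that lie below it. -/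
def lcMinorant (M : ℕ → ℝ) (j : ℕ) : ℝ :=
  sSup {x : ℝ | ∃ L : ℕ → ℝ, (∀ i, 0 < L i) ∧ LogConvex L ∧ (∀ i, L i ≤ M i) ∧ x = L j}

/-- The regularized matrix `M^α`, whose sequences are
`j ^ ((α - 1) j) * (lc minorant of i ↦ i ^ ((1 - α) i) * M^(p)_i)_j`. -/
def regularized (M : SeqFamily) (α : ℝ) : SeqFamily := fun p j =>
  gevreyBar (α - 1) j * lcMinorant (fun i => gevreyBar (1 - α) i * M p i) j

/-- `M ≼ L`: there are `A, B > 0` with `M_j ≤ A B^j L_j` for all `j`. -/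
def Preceq (M L : ℕ → ℝ) : Prop :=
  ∃ A B : ℝ, 0 < A ∧ 0 < B ∧ ∀ j, M j ≤ A * B ^ j * L j

/-- The sequence `M°`: `M°_0 = 1`, and for `k ≥ 1`, `M°_k` is the maximum of
`M_ℓ * M_{j_1} * ⋯ * M_{j_ℓ}` over all `(j_1, …, j_ℓ)` with `j_i ≥ 1` and `j_1 + ⋯ + j_ℓ = k`
(the supremum below is over a finite nonempty index type). -/
def circ (M : ℕ → ℝ) (k : ℕ) : ℝ :=
  if k = 0 then 1
  else ⨆ c : Composition k, M c.length * ∏ i : Fin c.length, M (c.blocksFun i)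

/-- Root almost increasing property of Roumieu type. -/
def Rai (M : SeqFamily) : Prop :=
  ∀ p, ∃ C : ℝ, 0 < C ∧ ∃ q, ∀ j k : ℕ, 1 ≤ j → j ≤ k →
    check (M p) j ^ (1 / (j : ℝ)) ≤ C * check (M q) k ^ (1 / (k : ℝ))

/-- Faà di Bruno property of Roumieu type. -/
def FdB (M : SeqFamily) : Prop :=
  ∀ p, ∃ q, Preceq (circ (check (M p))) (check (M q))

/-- Derivation closedness of Roumieu type. -/
def Dc (M : SeqFamily) : Prop :=
  ∀ p, ∃ C : ℝ, 0 < C ∧ ∃ q, ∀ j : ℕ, M p (j + 1) ≤ C ^ (j + 1) * M q j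

/-- For some `p`, `liminf_j (M^(p)_j / j!)^(1/j) > 0` (the limes inferior may be `+∞`, and is
therefore taken in `[0, ∞]`). -/
def COmega (M : SeqFamily) : Prop :=
  ∃ p, 0 < liminf (fun j : ℕ => ENNReal.ofReal (check (M p) j ^ (1 / (j : ℝ)))) atTop

/-- The unbounded open sector of opening `α π`, bisected by the positive real axis, in the case
`0 < α ≤ 1`, in which it is a subset of the open right half-plane. -/
def sector (α : ℝ) : Set ℂ := {z | z ≠ 0 ∧ |z.arg| < α * Real.pi / 2}

/-- `f` satisfies `sup_{z ∈ E, j ∈ ℕ₀} |f^(j)(z)| / (h^j M_j) < ∞` for some `h > 0`. -/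
def DerivBound (M : ℕ → ℝ) (E : Set ℂ) (f : ℂ → ℂ) : Prop :=
  ∃ h : ℝ, 0 < h ∧ ∃ C : ℝ, ∀ z ∈ E, ∀ j : ℕ, ‖iteratedDeriv j f z‖ ≤ C * (h ^ j * M j)

/-- The Roumieu ultraholomorphic class of a matrix on an open set `S`. Functions on `S` are
represented by total functions; only the restriction to `S` matters. -/
def ultraClass (M : SeqFamily) (S : Set ℂ) : Set (ℂ → ℂ) :=
  {f | DifferentiableOn ℂ f S ∧ ∃ p, DerivBound (M p) S f}

/-- The class of functions `g`, holomorphic on the open set `U`, such that for every compact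
`K ⊆ U` there is `p` for which `g` satisfies the estimates of `M^(p)` on `K`. -/
def localClass (M : SeqFamily) (U : Set ℂ) : Set (ℂ → ℂ) :=
  {g | DifferentiableOn ℂ g U ∧
    ∀ K : Set ℂ, IsCompact K → K ⊆ U → ∃ p, DerivBound (M p) K g}

/-- The class on `S` is holomorphically closed. -/
def HolomorphicallyClosed (M : SeqFamily) (S : Set ℂ) : Prop :=
  ∀ f ∈ ultraClass M S, ∀ U : Set ℂ, IsOpen U → closure (f '' S) ⊆ U →
    ∀ g : ℂ → ℂ, DifferentiableOn ℂ g U → g ∘ f ∈ ultraClass M S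

/-- The class on `S` is inverse-closed: `1 / f` is in it if `f` is and `inf_S |f| > 0`. -/
def InverseClosed (M : SeqFamily) (S : Set ℂ) : Prop :=
  ∀ f ∈ ultraClass M S, (∃ δ : ℝ, 0 < δ ∧ ∀ z ∈ S, δ ≤ ‖f z‖) →
    (fun z => 1 / f z) ∈ ultraClass M S

/-- The class on `S` is closed under composition. -/
def CompositionClosed (M : SeqFamily) (S : Set ℂ) : Prop :=
  ∀ f ∈ ultraClass M S, ∀ U : Set ℂ, IsOpen U → closure (f '' S) ⊆ U →
    ∀ g ∈ localClass M U, g ∘ f ∈ ultraClass M S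

end Ultraholomorphic

end

open Ultraholomorphic

namespace Ultraholomorphic

/-! On a sector the class of `M` is governed by the regularized matrix, and every sequence of that
matrix is attained, up to geometric factors, by the derivatives of some function at the vertex. Once
both facts are known, the equivalences become statements about Taylor coefficients.

Upper bound (`derivBound_regularized`). Intermediate derivatives on the sector satisfy a
Landau-Kolmogorov inequality with the factor (n/k)^((1-α)k) (`norm_iteratedDeriv_le_interpolation`).
The Taylor polynomial of F at z is controlled in all directions w of the closed sector, since z + w
stays in the sector. The map ζ ↦ -R ζ^(2-α) opens the complement of the sector to a half-plane,
where Phragmén-Lindelöf extends the control to a full disc, and Cauchy's estimate then bounds the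
coefficient. To bound the derivative of order j, take a geometric sequence lying below i^((1-α)i)
M_i that touches it at j or at two indices around j (`exists_geometric_contact`). In the second case
interpolate between these indices; convexity of x log x absorbs the factor (`mul_log_add_le`).

Lower bound (`IsRegularizable.exists_extremal`). The Wright function ∑ (-z)^n / (n! Γ((1-α)n+2)) has
derivatives of size about j^((α-1)j), both on the sector and at 0, where their signs alternate. A
weighted sum of its dilates, one for each tangent of the log-convex minorant, satisfies the
regularized estimates and nearly attains them at the vertex.

(c) ⇒ (a): if f is extremal, the reciprocal of a constant minus f has, up to alternating signs,
nonnegative Taylor coefficients at 0. Its coefficient of order lj dominates, up to geometric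
factors, the l-th power of the j-th coefficient of f. The upper bound for this reciprocal yields the
root property for multiples, which suffices (`IsRegularizable.rai_of_multiples`). (a) ⇒ (b): in the
Faà di Bruno formula the root property bounds each block of length b by the b-th power of one
number, the k-th root of the target. (b) ⇒ (c) is the case g(w) = 1/w.

Under the real analytic condition every holomorphic g lies in the local class, so (d) is (b). In
(e), derivation closedness pays for the outer factor of `circ`, and conversely the real analytic
condition bounds that factor below. -/

/-! ### Sectors -/

/-- The closed sector of opening `α π`, described by two linear inequalities. -/
def closedSector (α : ℝ) : Set ℂ :=
  {z | |z.im| * Real.cos (α * Real.pi / 2) ≤ z.re * Real.sin (α * Real.pi / 2)}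

/-- With θ = απ/2, the difference of the two sides is |z| sin(θ - |arg z|). The linear form makes
openness, convexity and stability under translation immediate. -/
theorem mem_sector_iff {α : ℝ} (hα0 : 0 < α) (hα1 : α ≤ 1) (z : ℂ) :
    z ∈ sector α ↔
      |z.im| * Real.cos (α * Real.pi / 2) < z.re * Real.sin (α * Real.pi / 2) := by
  have hπ := Real.pi_pos
  set θ := α * Real.pi / 2 with hθ
  have hθ0 : 0 < θ := by positivity
  have hθ1 : θ ≤ Real.pi / 2 := by rw [hθ]; nlinarith
  by_cases hz : z = 0
  · simp [sector, hz]
  have hr : 0 < ‖z‖ := norm_pos_iff.2 hz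
  have hre : z.re = ‖z‖ * Real.cos |z.arg| := by rw [Real.cos_abs, Complex.norm_mul_cos_arg]
  have him : |z.im| = ‖z‖ * Real.sin |z.arg| := by
    rw [← Real.abs_sin_eq_sin_abs_of_abs_le_pi (Complex.abs_arg_le_pi z)]
    conv_lhs => rw [← Complex.norm_mul_sin_arg z, abs_mul, abs_of_pos hr]
  have key : z.re * Real.sin θ - |z.im| * Real.cos θ = ‖z‖ * Real.sin (θ - |z.arg|) := by
    rw [hre, him, Real.sin_sub]; ring
  have hpi := Complex.abs_arg_le_pi z
  have h0 := abs_nonneg z.arg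
  constructor
  · rintro ⟨-, h⟩
    have : 0 < Real.sin (θ - |z.arg|) := Real.sin_pos_of_pos_of_lt_pi (by linarith) (by linarith)
    have := mul_pos hr this
    linarith
  · intro h
    refine ⟨hz, ?_⟩
    by_contra hcon
    push Not at hcon
    have : Real.sin (θ - |z.arg|) ≤ 0 :=
      Real.sin_nonpos_of_nonpos_of_neg_pi_le (by linarith) (by linarith)
    have := mul_nonpos_of_nonneg_of_nonpos hr.le this
    linarith

theorem isOpen_sector {α : ℝ} (hα0 : 0 < α) (hα1 : α ≤ 1) : IsOpen (sector α) := by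
  have : sector α = {z : ℂ | |z.im| * Real.cos (α * Real.pi / 2)
      < z.re * Real.sin (α * Real.pi / 2)} := by
    ext z; exact mem_sector_iff hα0 hα1 z
  rw [this]
  exact isOpen_lt (by fun_prop) (by fun_prop)

theorem cos_half_opening_nonneg {α : ℝ} (hα0 : 0 < α) (hα1 : α ≤ 1) :
    0 ≤ Real.cos (α * Real.pi / 2) := by
  have hπ := Real.pi_pos
  exact Real.cos_nonneg_of_mem_Icc ⟨by nlinarith, by nlinarith⟩

theorem sin_half_opening_pos {α : ℝ} (hα0 : 0 < α) (hα1 : α ≤ 1) :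
    0 < Real.sin (α * Real.pi / 2) := by
  have hπ := Real.pi_pos
  exact Real.sin_pos_of_pos_of_lt_pi (by positivity) (by nlinarith)

theorem add_mem_sector {α : ℝ} (hα0 : 0 < α) (hα1 : α ≤ 1) {z w : ℂ} (hz : z ∈ sector α)
    (hw : w ∈ closedSector α) : z + w ∈ sector α := by
  rw [mem_sector_iff hα0 hα1] at hz ⊢
  have hw : |w.im| * Real.cos (α * Real.pi / 2) ≤ w.re * Real.sin (α * Real.pi / 2) := hw
  have := mul_le_mul_of_nonneg_right (abs_add_le z.im w.im) (cos_half_opening_nonneg hα0 hα1)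
  simp only [Complex.add_im, Complex.add_re]
  linarith

theorem smul_mem_closedSector {α : ℝ} {w : ℂ} (hw : w ∈ closedSector α) {t : ℝ} (ht : 0 ≤ t) :
    (t : ℂ) * w ∈ closedSector α := by
  have hw : |w.im| * Real.cos (α * Real.pi / 2) ≤ w.re * Real.sin (α * Real.pi / 2) := hw
  have := mul_le_mul_of_nonneg_left hw ht
  simp only [closedSector, Set.mem_ofPred_eq, Complex.mul_im, Complex.mul_re, Complex.ofReal_re,
    Complex.ofReal_im, zero_mul, add_zero, sub_zero, abs_mul, abs_of_nonneg ht]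
  linarith

theorem ofReal_mem_sector {α : ℝ} (hα0 : 0 < α) {x : ℝ} (hx : 0 < x) : (x : ℂ) ∈ sector α := by
  have hπ := Real.pi_pos
  refine ⟨by exact_mod_cast hx.ne', ?_⟩
  rw [Complex.arg_ofReal_of_nonneg hx.le]
  simpa using by positivity

/-! ### A Bernstein-Walsh estimate at the vertex of a sector -/

/-- The power sends arguments ±π/2 to ±(π - απ/2), so after the change of sign the imaginary axis
lands on the two boundary rays of the sector. -/
theorem neg_cpow_mem_closedSector {α : ℝ} (hα0 : 0 < α) (hα1 : α ≤ 1) {R : ℝ} (hR : 0 < R)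
    (y : ℝ) :
    -((R : ℂ) * ((y : ℂ) * Complex.I) ^ ((2 - α : ℝ) : ℂ)) ∈ closedSector α := by
  by_cases hy : y = 0
  · have : ((2 - α : ℝ) : ℂ) ≠ 0 := by exact_mod_cast (by linarith : (2 - α : ℝ) ≠ 0)
    rw [hy, Complex.ofReal_zero, zero_mul, Complex.zero_cpow this]
    simp [closedSector]
  have hne : (y : ℂ) * Complex.I ≠ 0 := by simp [hy]
  have hc : ((y : ℂ) * Complex.I) ^ ((2 - α : ℝ) : ℂ) =
      ((|y| ^ (2 - α) : ℝ) : ℂ) *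
        Complex.exp (((2 - α) * ((y : ℂ) * Complex.I).arg : ℝ) * Complex.I) := by
    rw [Complex.cpow_def_of_ne_zero hne, Complex.log, Real.rpow_def_of_pos (abs_pos.2 hy)]
    push_cast
    rw [← Complex.exp_add]
    congr 1
    simp only [norm_mul, Complex.norm_I, mul_one, Complex.norm_real, Real.norm_eq_abs]
    ring
  have hcos : Real.cos ((2 - α) * (Real.pi / 2)) = -Real.cos (α * Real.pi / 2) := by
    rw [← Real.cos_pi_sub]; congr 1; ring
  have hsin : Real.sin ((2 - α) * (Real.pi / 2)) = Real.sin (α * Real.pi / 2) := by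
    rw [← Real.sin_pi_sub]; congr 1; ring
  have harg : ((y : ℂ) * Complex.I).arg = Real.pi / 2 ∨
      ((y : ℂ) * Complex.I).arg = -(Real.pi / 2) := by
    rcases lt_or_gt_of_ne hy with h | h
    · right; rw [Complex.arg_eq_neg_pi_div_two_iff]; simpa using h
    · left; rw [Complex.arg_eq_pi_div_two_iff]; simpa using h
  have hY : 0 ≤ |y| ^ (2 - α) := by positivity
  have hS := (sin_half_opening_pos hα0 hα1).le
  rw [hc]
  simp only [closedSector, Set.mem_ofPred_eq, Complex.neg_im, Complex.neg_re, ← mul_assoc,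
    ← Complex.ofReal_mul, Complex.re_ofReal_mul, Complex.im_ofReal_mul, Complex.exp_ofReal_mul_I_re,
    Complex.exp_ofReal_mul_I_im, abs_neg, abs_mul]
  rw [abs_of_pos hR, abs_of_nonneg hY]
  rcases harg with h | h <;> rw [h]
  · rw [hcos, hsin, abs_of_nonneg hS]; linarith
  · rw [mul_neg, Real.cos_neg, Real.sin_neg, hcos, hsin, abs_neg, abs_of_nonneg hS]; linarith

/-- Split on the argument of x = -w/R: if it is at most (2-α)π/2 in modulus, the principal root of x
lies in the closed right half-plane; otherwise w is within απ/2 of the positive axis. -/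
theorem mem_closedSector_or_eq_neg_cpow {α : ℝ} (hα1 : α ≤ 1) {R : ℝ} (hR : 0 < R)
    {w : ℂ} (hw : w ≠ 0) :
    w ∈ closedSector α ∨ ∃ ζ : ℂ, 0 ≤ ζ.re ∧ ‖ζ‖ = (‖w‖ / R) ^ (1 / (2 - α)) ∧
      w = -((R : ℂ) * ζ ^ ((2 - α : ℝ) : ℂ)) := by
  have hπ := Real.pi_pos
  have hβ : 0 < 2 - α := by linarith
  have hRC : (R : ℂ) ≠ 0 := by exact_mod_cast hR.ne'
  set x : ℂ := -w / R with hx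
  have hx0 : x ≠ 0 := div_ne_zero (neg_ne_zero.2 hw) hRC
  have hwx : w = -((R : ℂ) * x) := by rw [hx]; field_simp
  have hnx : ‖x‖ = ‖w‖ / R := by
    rw [hx, norm_div, norm_neg, Complex.norm_real, Real.norm_of_nonneg hR.le]
  by_cases harg : |x.arg| ≤ (2 - α) * (Real.pi / 2)
  · right
    have h2 : |x.arg / (2 - α)| ≤ Real.pi / 2 := by
      rw [abs_div, abs_of_pos hβ, div_le_iff₀ hβ]; linarith
    have h3 := abs_le.1 h2
    have him : (Complex.log x * ((1 / (2 - α) : ℝ) : ℂ)).im = x.arg / (2 - α) := by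
      rw [Complex.im_mul_ofReal, Complex.log_im]; ring
    refine ⟨x ^ ((1 / (2 - α) : ℝ) : ℂ), ?_, ?_, ?_⟩
    · rw [Complex.cpow_def_of_ne_zero hx0, Complex.exp_re, him]
      exact mul_nonneg (Real.exp_pos _).le (Real.cos_nonneg_of_mem_Icc h3)
    · rw [Complex.norm_cpow_real, hnx]
    · rw [← Complex.cpow_mul _ (by rw [him]; linarith) (by rw [him]; linarith),
        ← Complex.ofReal_mul, one_div_mul_cancel hβ.ne', Complex.ofReal_one, Complex.cpow_one]
      exact hwx
  · left
    push Not at harg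
    have hr : 0 < ‖x‖ := norm_pos_iff.2 hx0
    have hre : x.re = ‖x‖ * Real.cos |x.arg| := by rw [Real.cos_abs, Complex.norm_mul_cos_arg]
    have him : |x.im| = ‖x‖ * Real.sin |x.arg| := by
      rw [← Real.abs_sin_eq_sin_abs_of_abs_le_pi (Complex.abs_arg_le_pi x)]
      conv_lhs => rw [← Complex.norm_mul_sin_arg x, abs_mul, abs_of_pos hr]
    have hs : Real.sin (|x.arg| + α * Real.pi / 2) ≤ 0 := by
      rw [← Real.sin_sub_two_pi]
      have := Complex.abs_arg_le_pi x
      exact Real.sin_nonpos_of_nonpos_of_neg_pi_le (by nlinarith) (by linarith)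
    rw [Real.sin_add] at hs
    have := mul_nonpos_of_nonneg_of_nonpos (mul_pos hR hr).le hs
    rw [hwx]
    simp only [closedSector, Set.mem_ofPred_eq, Complex.neg_im, Complex.neg_re,
      Complex.re_ofReal_mul, Complex.im_ofReal_mul, abs_neg, abs_mul, abs_of_pos hR]
    rw [hre, him]
    linarith

theorem one_le_norm_one_add {ζ : ℂ} (h : 0 ≤ ζ.re) : 1 ≤ ‖1 + ζ‖ :=
  le_trans (by simpa using h) (Complex.re_le_norm _)

theorem norm_le_norm_one_add {ζ : ℂ} (h : 0 ≤ ζ.re) : ‖ζ‖ ≤ ‖1 + ζ‖ := by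
  rw [Complex.norm_def, Complex.norm_def]
  apply Real.sqrt_le_sqrt
  simp only [Complex.normSq_apply, Complex.add_re, Complex.one_re, Complex.add_im, Complex.one_im]
  nlinarith

theorem norm_rpow_le_norm_one_add_pow {α : ℝ} (hα0 : 0 < α) (hα1 : α ≤ 1) {ζ : ℂ} (h : 0 ≤ ζ.re)
    {i n : ℕ} (hi : i ≤ n) : (‖ζ‖ ^ (2 - α)) ^ i ≤ ‖1 + ζ‖ ^ (2 * n) := by
  have h1 := one_le_norm_one_add h
  have h2 : ‖ζ‖ ^ (2 - α) ≤ ‖1 + ζ‖ ^ 2 := by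
    calc ‖ζ‖ ^ (2 - α) ≤ ‖1 + ζ‖ ^ (2 - α) :=
          Real.rpow_le_rpow (norm_nonneg _) (norm_le_norm_one_add h) (by linarith)
      _ ≤ ‖1 + ζ‖ ^ (2 : ℝ) := Real.rpow_le_rpow_of_exponent_le h1 (by linarith)
      _ = ‖1 + ζ‖ ^ 2 := by norm_cast
  calc (‖ζ‖ ^ (2 - α)) ^ i ≤ (‖1 + ζ‖ ^ 2) ^ i := by gcongr
    _ ≤ (‖1 + ζ‖ ^ 2) ^ n := pow_le_pow_right₀ (one_le_pow₀ h1) hi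
    _ = _ := by rw [pow_mul]

/-- Pull the polynomial back to the right half-plane and divide by (1+ζ)^(2n), which dominates both
1 and |ζ|^((2-α)n). The quotient is bounded, is at most 2A on the imaginary axis by the hypothesis,
and so is at most 2A throughout. Finally |1+ζ|^(2n) ≤ e^(2n|ζ|). -/
theorem norm_polynomial_le_of_sector_bound {α : ℝ} (hα0 : 0 < α) (hα1 : α ≤ 1) {n : ℕ}
    {A R : ℝ} (hA : 0 < A) (hR : 0 < R) (a : ℕ → ℂ)
    (hP : ∀ w ∈ closedSector α,
      ‖∑ i ∈ Finset.range n, a i * w ^ i‖ ≤ A * (1 + (‖w‖ / R) ^ n))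
    {w : ℂ} (hw : ‖w‖ ≤ R) :
    ‖∑ i ∈ Finset.range n, a i * w ^ i‖ ≤
      2 * A * Real.exp (2 * n * (‖w‖ / R) ^ (1 / (2 - α))) := by
  have hβ : 0 < 2 - α := by linarith
  have hβ0 : ((2 - α : ℝ) : ℂ) ≠ 0 := by exact_mod_cast hβ.ne'
  have hcase : w ∈ closedSector α → ‖∑ i ∈ Finset.range n, a i * w ^ i‖ ≤
      2 * A * Real.exp (2 * n * (‖w‖ / R) ^ (1 / (2 - α))) := by
    intro h
    have h1 : (‖w‖ / R) ^ n ≤ 1 := pow_le_one₀ (by positivity) ((div_le_one hR).2 hw)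
    have h2 : 1 ≤ Real.exp (2 * n * (‖w‖ / R) ^ (1 / (2 - α))) :=
      Real.one_le_exp (by positivity)
    calc _ ≤ A * (1 + (‖w‖ / R) ^ n) := hP w h
      _ ≤ A * (1 + 1) := by gcongr
      _ = 2 * A * 1 := by ring
      _ ≤ _ := by gcongr
  by_cases hw0 : w = 0
  · exact hcase (by simp [hw0, closedSector])
  rcases mem_closedSector_or_eq_neg_cpow hα1 hR hw0 with h | ⟨ζ, hζre, hζn, hζ⟩
  · exact hcase h
  set P : ℂ → ℂ := fun w => ∑ i ∈ Finset.range n, a i * w ^ i with hPdef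
  set V : ℂ → ℂ := fun ζ => -((R : ℂ) * ζ ^ ((2 - α : ℝ) : ℂ)) with hV
  set Q : ℂ → ℂ := fun ζ => P (V ζ) / (1 + ζ) ^ (2 * n) with hQ
  have hVn : ∀ ζ : ℂ, ‖V ζ‖ = R * ‖ζ‖ ^ (2 - α) := by
    intro ζ
    rw [hV]
    simp only [norm_neg, norm_mul, Complex.norm_real, Real.norm_of_nonneg hR.le,
      Complex.norm_cpow_real]
  have hne : ∀ ζ : ℂ, 0 ≤ ζ.re → (1 + ζ) ^ (2 * n) ≠ 0 := fun ζ h =>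
    pow_ne_zero _ (norm_pos_iff.1 (lt_of_lt_of_le one_pos (one_le_norm_one_add h)))
  have hPd : Differentiable ℂ P := by rw [hPdef]; fun_prop
  have hslit : ∀ ζ : ℂ, 0 ≤ ζ.re → ζ ≠ 0 → ζ ∈ Complex.slitPlane := by
    intro ζ h h0
    rw [Complex.mem_slitPlane_iff]
    rcases h.lt_or_eq with h | h
    · exact Or.inl h
    · right; intro him; exact h0 (Complex.ext h.symm him)
  have hVc : ∀ ζ : ℂ, 0 ≤ ζ.re → ContinuousAt V ζ := by
    intro ζ h
    by_cases h0 : ζ = 0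
    · subst h0
      have : Tendsto (fun ζ : ℂ => R * ‖ζ‖ ^ (2 - α)) (𝓝 0) (𝓝 0) := by
        have : ContinuousAt (fun ζ : ℂ => R * ‖ζ‖ ^ (2 - α)) 0 :=
          continuousAt_const.mul (continuous_norm.continuousAt.rpow_const (Or.inr hβ.le))
        simpa [ContinuousAt, Real.zero_rpow hβ.ne'] using this
      have hV0 : V 0 = 0 := by rw [hV]; simp only [Complex.zero_cpow hβ0, mul_zero, neg_zero]
      rw [ContinuousAt, hV0]
      exact squeeze_zero_norm (fun ζ => (hVn ζ).le) this
    · exact (continuousAt_const.mul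
        (continuousAt_cpow_const (hslit ζ h h0))).neg
  have hd : DiffContOnCl ℂ Q {z | 0 < z.re} := by
    constructor
    · intro ζ h
      have h : 0 < ζ.re := h
      have h0 : ζ ≠ 0 := by rintro rfl; simp at h
      have : DifferentiableAt ℂ V ζ :=
        ((differentiableAt_id.cpow_const (hslit ζ h.le h0)).const_mul _).neg
      exact ((hPd.differentiableAt.comp ζ this).div (by fun_prop)
        (hne ζ h.le)).differentiableWithinAt
    · rw [Complex.closure_setOfPred_lt_re]
      intro ζ h
      exact ((hPd.continuous.continuousAt.comp (hVc ζ h)).div (by fun_prop)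
        (hne ζ h)).continuousWithinAt
  -- This crude bound, in terms of the coefficients, only serves as the growth hypothesis of
  -- Phragmén-Lindelöf.
  have hbd : ∀ ζ : ℂ, 0 ≤ ζ.re → ‖Q ζ‖ ≤ ∑ i ∈ Finset.range n, ‖a i‖ * R ^ i := by
    intro ζ h
    have h1 := one_le_norm_one_add h
    rw [hQ]
    simp only [norm_div, norm_pow]
    rw [div_le_iff₀ (by positivity), hPdef, Finset.sum_mul]
    refine (norm_sum_le _ _).trans (Finset.sum_le_sum fun i hi => ?_)
    rw [norm_mul, norm_pow, hVn, mul_pow, ← mul_assoc]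
    have := norm_rpow_le_norm_one_add_pow hα0 hα1 h (Finset.mem_range.1 hi).le
    gcongr
  have hQle : ‖Q ζ‖ ≤ 2 * A := by
    refine PhragmenLindelof.right_half_plane_of_bounded_on_real hd ⟨0, by norm_num, 0, ?_⟩ ?_ ?_
      hζre
    · simp only [zero_mul, Real.exp_zero]
      refine Asymptotics.IsBigO.of_bound (∑ i ∈ Finset.range n, ‖a i‖ * R ^ i) ?_
      refine Filter.mem_inf_of_right ?_
      intro ζ h
      simpa using hbd ζ (le_of_lt h)
    · refine ⟨∑ i ∈ Finset.range n, ‖a i‖ * R ^ i, ?_⟩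
      rw [Filter.eventually_map]
      filter_upwards [eventually_ge_atTop (0 : ℝ)] with x hx
      exact hbd x (by simpa using hx)
    · intro y
      have hre : 0 ≤ ((y : ℂ) * Complex.I).re := by simp
      have h1 := one_le_norm_one_add hre
      rw [hQ]
      simp only [norm_div, norm_pow]
      rw [div_le_iff₀ (by positivity)]
      have h2 := hP _ (neg_cpow_mem_closedSector hα0 hα1 hR y)
      have h3 := norm_rpow_le_norm_one_add_pow hα0 hα1 hre (le_refl n)
      have h4 : 1 ≤ ‖1 + (y : ℂ) * Complex.I‖ ^ (2 * n) := one_le_pow₀ h1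
      have h5 : ‖V (y * Complex.I)‖ / R = ‖(y : ℂ) * Complex.I‖ ^ (2 - α) := by
        rw [hVn]; field_simp
      calc ‖P (V (y * Complex.I))‖ ≤ A * (1 + (‖V (y * Complex.I)‖ / R) ^ n) := h2
        _ = A * (1 + (‖(y : ℂ) * Complex.I‖ ^ (2 - α)) ^ n) := by rw [h5]
        _ ≤ A * (‖1 + (y : ℂ) * Complex.I‖ ^ (2 * n) + ‖1 + (y : ℂ) * Complex.I‖ ^ (2 * n)) := by
          gcongr
        _ = _ := by ring
  have hpos : 0 < ‖1 + ζ‖ := lt_of_lt_of_le one_pos (one_le_norm_one_add hζre)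
  rw [hQ] at hQle
  simp only [norm_div, norm_pow] at hQle
  rw [div_le_iff₀ (by positivity)] at hQle
  have hfin : ‖1 + ζ‖ ^ (2 * n) ≤ Real.exp (2 * n * (‖w‖ / R) ^ (1 / (2 - α))) := by
    rw [← hζn]
    calc ‖1 + ζ‖ ^ (2 * n) ≤ (Real.exp ‖ζ‖) ^ (2 * n) := by
          gcongr
          calc ‖1 + ζ‖ ≤ ‖(1 : ℂ)‖ + ‖ζ‖ := norm_add_le _ _
            _ ≤ Real.exp ‖ζ‖ := by rw [norm_one]; linarith [Real.add_one_le_exp ‖ζ‖]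
      _ = _ := by rw [← Real.exp_nat_mul]; push_cast; ring_nf
  have hVw : V ζ = w := hζ.symm
  rw [hVw] at hQle
  exact hQle.trans (by gcongr)

/-! ### An interpolation inequality for derivatives on sectors -/

theorem analyticAt_iteratedDeriv {f : ℂ → ℂ} {S : Set ℂ} (hS : IsOpen S)
    (hf : DifferentiableOn ℂ f S) (j : ℕ) {z : ℂ} (hz : z ∈ S) :
    AnalyticAt ℂ (iteratedDeriv j f) z := by
  rw [iteratedDeriv_eq_iterate]
  exact (hf.analyticOnNhd hS).iterated_deriv j z hz

theorem hasDerivAt_iteratedDeriv {f : ℂ → ℂ} {S : Set ℂ} (hS : IsOpen S)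
    (hf : DifferentiableOn ℂ f S) (j : ℕ) {z : ℂ} (hz : z ∈ S) :
    HasDerivAt (iteratedDeriv j f) (iteratedDeriv (j + 1) f z) z := by
  rw [iteratedDeriv_succ]
  exact (analyticAt_iteratedDeriv hS hf j hz).differentiableAt.hasDerivAt

/-- Induction on n: the derivative of the Taylor remainder of φ 0 is the remainder of one order less
of φ 1, and the mean value inequality integrates the bound. -/
theorem norm_sub_taylor_le {n : ℕ} {B : ℝ} {φ : ℕ → ℝ → ℂ}
    (hd : ∀ i < n, ∀ t ∈ Set.Icc (0 : ℝ) 1, HasDerivAt (φ i) (φ (i + 1) t) t)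
    (hB : ∀ t ∈ Set.Icc (0 : ℝ) 1, ‖φ n t‖ ≤ B) {t : ℝ} (ht : t ∈ Set.Icc (0 : ℝ) 1) :
    ‖φ 0 t - ∑ i ∈ Finset.range n, φ i 0 * (t : ℂ) ^ i / (i.factorial : ℂ)‖ ≤
      B * t ^ n / (n.factorial : ℝ) := by
  induction n generalizing φ t with
  | zero => simpa using hB t ht
  | succ n ih =>
    have ih' := fun t ht => ih (φ := fun i => φ (i + 1)) (t := t)
      (fun i hi => hd (i + 1) (by omega)) hB ht
    have hder : ∀ t ∈ Set.Icc (0 : ℝ) 1, HasDerivAt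
        (fun t : ℝ => φ 0 t - ∑ i ∈ Finset.range (n + 1), φ i 0 * (t : ℂ) ^ i / (i.factorial : ℂ))
        (φ 1 t - ∑ i ∈ Finset.range n, φ (i + 1) 0 * (t : ℂ) ^ i / (i.factorial : ℂ)) t := by
      intro t ht
      refine (hd 0 (by omega) t ht).sub ?_
      simp only [Finset.sum_range_succ' _ n]
      rw [← add_zero (∑ i ∈ Finset.range n, φ (i + 1) 0 * (t : ℂ) ^ i / (i.factorial : ℂ))]
      refine HasDerivAt.add (HasDerivAt.fun_sum fun i _ => ?_) ?_
      · have h1 : HasDerivAt (fun t : ℝ => (t : ℂ) ^ (i + 1)) (((i + 1 : ℕ) : ℂ) * (t : ℂ) ^ i) t := by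
          have := (hasDerivAt_pow (i + 1) (t : ℂ)).comp_ofReal
          simpa using this
        have h2 := (h1.const_mul (φ (i + 1) 0)).div_const (((i + 1).factorial : ℕ) : ℂ)
        refine h2.congr_deriv ?_
        rw [Nat.factorial_succ]
        push_cast
        have h3 : (i.factorial : ℂ) ≠ 0 := by exact_mod_cast i.factorial_ne_zero
        have h4 : (i : ℂ) + 1 ≠ 0 := by exact_mod_cast i.succ_ne_zero
        field_simp
      · simpa using hasDerivAt_const t (φ 0 0)
    refine image_norm_le_of_norm_deriv_right_le_deriv_boundary (a := 0) (b := 1)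
      (B := fun t => B * t ^ (n + 1) / ((n + 1).factorial : ℝ))
      (B' := fun t => B * t ^ n / (n.factorial : ℝ))
      (fun t ht => (hder t ht).continuousAt.continuousWithinAt)
      (fun t ht => (hder t ⟨ht.1, ht.2.le⟩).hasDerivWithinAt) ?_ ?_ ?_ ht
    · rw [Finset.sum_range_succ']; simp
    · intro t
      have h2 := ((hasDerivAt_pow (n + 1) t).const_mul B).div_const ((n + 1).factorial : ℝ)
      refine h2.congr_deriv ?_
      rw [Nat.factorial_succ]
      push_cast
      have h3 : (n.factorial : ℝ) ≠ 0 := by exact_mod_cast n.factorial_ne_zero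
      have h4 : (n : ℝ) + 1 ≠ 0 := by positivity
      field_simp
    · exact fun t ht => ih' t ⟨ht.1, ht.2.le⟩

theorem pow_div_exp_le_factorial (n : ℕ) :
    ((n : ℝ) / Real.exp 1) ^ n ≤ (n.factorial : ℝ) := by
  have h := Real.pow_div_factorial_le_exp (n : ℝ) (Nat.cast_nonneg n) n
  have h1 : (0 : ℝ) < n.factorial := by exact_mod_cast n.factorial_pos
  rw [div_le_iff₀ h1] at h
  rw [div_pow, ← Real.exp_nat_mul, mul_one, div_le_iff₀ (Real.exp_pos _)]
  linarith

/-- The Taylor polynomial of degree less than n at z differs from F(z+w) by at most B|w|^n/n! on the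
closed sector. The preceding estimate bounds it on a disc, and Cauchy's inequality there bounds its
k-th coefficient. -/
theorem norm_iteratedDeriv_le_interpolation {α : ℝ} (hα0 : 0 < α) (hα1 : α ≤ 1) {F : ℂ → ℂ}
    (hF : DifferentiableOn ℂ F (sector α)) {A B : ℝ} (hA : 0 < A) (hB : 0 < B) {n k : ℕ}
    (hk : 1 ≤ k) (hkn : k < n) (h0 : ∀ z ∈ sector α, ‖F z‖ ≤ A)
    (hn : ∀ z ∈ sector α, ‖iteratedDeriv n F z‖ ≤ B) {z : ℂ} (hz : z ∈ sector α) :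
    ‖iteratedDeriv k F z‖ ≤ 2 * Real.exp (3 * k) * ((n : ℝ) / k) ^ ((1 - α) * k) *
      (A ^ (1 - (k : ℝ) / n) * B ^ ((k : ℝ) / n)) := by
  have hS := isOpen_sector hα0 hα1
  have hβ : 0 < 2 - α := by linarith
  have hk0 : (0 : ℝ) < k := by exact_mod_cast hk
  have hn0 : (0 : ℝ) < n := by exact_mod_cast (by omega : 0 < n)
  have hnn : n ≠ 0 := by omega
  have hnf : (0 : ℝ) < n.factorial := by exact_mod_cast n.factorial_pos
  set a : ℕ → ℂ := fun i => iteratedDeriv i F z / (i.factorial : ℂ) with ha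
  -- At |w| = R the Taylor remainder bound B|w|^n/n! equals A.
  set R : ℝ := (A * n.factorial / B) ^ (1 / (n : ℝ)) with hRdef
  have hR : 0 < R := by positivity
  have hRn : R ^ n = A * n.factorial / B := by
    rw [hRdef, ← Real.rpow_natCast, ← Real.rpow_mul (by positivity), one_div_mul_cancel hn0.ne',
      Real.rpow_one]
  have hP : ∀ w ∈ closedSector α,
      ‖∑ i ∈ Finset.range n, a i * w ^ i‖ ≤ A * (1 + (‖w‖ / R) ^ n) := by
    intro w hw
    have hmem : ∀ t ∈ Set.Icc (0 : ℝ) 1, z + (t : ℂ) * w ∈ sector α := fun t ht =>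
      add_mem_sector hα0 hα1 hz (smul_mem_closedSector hw ht.1)
    have key := norm_sub_taylor_le (n := n) (B := B * ‖w‖ ^ n)
      (φ := fun i t => iteratedDeriv i F (z + (t : ℂ) * w) * w ^ i) (t := 1) ?_ ?_ (by simp)
    · simp only [Complex.ofReal_one, one_mul, pow_zero, mul_one, iteratedDeriv_zero, one_pow,
        Complex.ofReal_zero, zero_mul, add_zero] at key
      have hsum : ∑ i ∈ Finset.range n, iteratedDeriv i F z * w ^ i / (i.factorial : ℂ) =
          ∑ i ∈ Finset.range n, a i * w ^ i :=
        Finset.sum_congr rfl fun i _ => by rw [ha]; ring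
      rw [hsum] at key
      have h1 : ‖F (z + w)‖ ≤ A := h0 _ (by simpa using hmem 1 (by simp))
      have h2 := norm_sub_norm_le (∑ i ∈ Finset.range n, a i * w ^ i) (F (z + w))
      rw [norm_sub_rev] at h2
      have h3 : A * (‖w‖ / R) ^ n = B * ‖w‖ ^ n / n.factorial := by
        rw [div_pow, hRn]; field_simp
      linarith
    · intro i _ t ht
      have h1 : HasDerivAt (fun t : ℝ => z + (t : ℂ) * w) w t := by
        simpa using ((hasDerivAt_id (t : ℂ)).mul_const w).const_add z |>.comp_ofReal
      have h2 := (hasDerivAt_iteratedDeriv hS hF i (hmem t ht)).comp t h1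
      refine (h2.mul_const (w ^ i)).congr_deriv ?_
      ring
    · intro t ht
      simp only [norm_mul, norm_pow]
      exact mul_le_mul_of_nonneg_right (hn _ (hmem t ht)) (by positivity)
  set x : ℝ := (k : ℝ) / n with hx
  have hx0 : 0 < x := by positivity
  have hx1 : x ≤ 1 := by rw [hx, div_le_one hn0]; exact_mod_cast hkn.le
  have hs0 : 0 < x ^ (2 - α) := by positivity
  -- The radius R x^(2-α), with x = k/n, turns the exponent 2n(|w|/R)^(1/(2-α)) into 2k.
  have hcauchy := Complex.norm_iteratedDeriv_le_of_forall_mem_sphere_norm_le (c := 0)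
    (R := R * x ^ (2 - α)) (C := 2 * A * Real.exp (2 * k))
    (f := fun w => ∑ i ∈ Finset.range n, a i * w ^ i) k (by positivity)
    (Differentiable.diffContOnCl (by fun_prop)) (by
      intro w hw
      have hw : ‖w‖ = R * x ^ (2 - α) := by simpa using hw
      have h1 : x ^ (2 - α) ≤ 1 := Real.rpow_le_one hx0.le hx1 hβ.le
      refine (norm_polynomial_le_of_sector_bound hα0 hα1 hA hR a hP ?_).trans_eq ?_
      · rw [hw]; exact mul_le_of_le_one_right hR.le h1
      · have h2 : (‖w‖ / R) ^ (1 / (2 - α)) = x := by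
          rw [hw, mul_div_cancel_left₀ _ hR.ne', ← Real.rpow_mul hx0.le, mul_one_div_cancel hβ.ne',
            Real.rpow_one]
        rw [h2, hx]
        congr 2
        field_simp)
  have hcoef : iteratedDeriv k (fun w => ∑ i ∈ Finset.range n, a i * w ^ i) 0 =
      iteratedDeriv k F z := by
    rw [iteratedDeriv_fun_sum (fun i _ => by fun_prop)]
    have : ∀ i ∈ Finset.range n, iteratedDeriv k (fun w : ℂ => a i * w ^ i) 0 =
        if i = k then iteratedDeriv k F z else 0 := by
      intro i _
      rw [iteratedDeriv_const_mul_field, iteratedDeriv_fun_pow_zero]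
      split_ifs with h h' h'
      · subst h
        rw [ha]
        exact div_mul_cancel₀ _ (by exact_mod_cast Nat.factorial_ne_zero _)
      · exact absurd h.symm h'
      · exact absurd h'.symm h
      · simp
    rw [Finset.sum_congr rfl this, Finset.sum_ite_eq' (Finset.range n) k]
    simp [hkn]
  rw [hcoef] at hcauchy
  refine hcauchy.trans ?_
  -- Replacing n! by (n/e)^n costs e^k after taking k-th powers, hence e^(3k) in the result.
  have hRlow : (A / B) ^ (1 / (n : ℝ)) * (n / Real.exp 1) ≤ R := by
    have h1 : n / Real.exp 1 ≤ (n.factorial : ℝ) ^ (1 / (n : ℝ)) := by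
      have := Real.rpow_le_rpow (by positivity) (pow_div_exp_le_factorial n)
        (by positivity : 0 ≤ 1 / (n : ℝ))
      rwa [one_div, Real.pow_rpow_inv_natCast (by positivity) hnn, ← one_div] at this
    calc _ ≤ (A / B) ^ (1 / (n : ℝ)) * (n.factorial : ℝ) ^ (1 / (n : ℝ)) := by gcongr
      _ = R := by
        rw [hRdef, ← Real.mul_rpow (by positivity) hnf.le]
        congr 1; ring
  have hkf : (k.factorial : ℝ) ≤ (k : ℝ) ^ k := by exact_mod_cast Nat.factorial_le_pow k
  have hAB : ((A / B) ^ (1 / (n : ℝ))) ^ k = A ^ x / B ^ x := by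
    rw [← Real.rpow_natCast, ← Real.rpow_mul (by positivity), Real.div_rpow hA.le hB.le, hx]
    congr 2 <;> ring
  have hAx : 0 < A ^ x := by positivity
  have hBx : 0 < B ^ x := by positivity
  have hlow : A ^ x / B ^ x * (n / Real.exp 1) ^ k * (x ^ (2 - α)) ^ k ≤
      (R * x ^ (2 - α)) ^ k := by
    rw [← hAB, ← mul_pow, ← mul_pow]
    gcongr
  calc (k.factorial : ℝ) * (2 * A * Real.exp (2 * k)) / (R * x ^ (2 - α)) ^ k
      ≤ (k : ℝ) ^ k * (2 * A * Real.exp (2 * k)) /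
        (A ^ x / B ^ x * (n / Real.exp 1) ^ k * (x ^ (2 - α)) ^ k) := by gcongr
    _ = _ := by
      have e1 : (x ^ (2 - α)) ^ k = x ^ k * x ^ ((1 - α) * k) := by
        rw [← Real.rpow_natCast, ← Real.rpow_mul hx0.le, ← Real.rpow_natCast,
          ← Real.rpow_add hx0]
        congr 1; ring
      have e2 : ((n : ℝ) / k) ^ ((1 - α) * k) = (x ^ ((1 - α) * k))⁻¹ := by
        rw [← Real.inv_rpow hx0.le, hx, inv_div]
      have e3 : A ^ (1 - x) = A / A ^ x := by rw [Real.rpow_sub hA, Real.rpow_one]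
      have e4 : Real.exp (3 * k) = Real.exp (2 * k) * Real.exp 1 ^ k := by
        rw [← Real.exp_nat_mul, ← Real.exp_add]; congr 1; ring
      have e5 : x ^ k = (k : ℝ) ^ k / (n : ℝ) ^ k := by rw [hx, div_pow]
      have hxp : 0 < x ^ ((1 - α) * k) := by positivity
      rw [e1, e2, e3, e4, e5, div_pow]
      field_simp

/-! ### Log-convex minorants -/

/-- This is a supporting line at j of the greatest convex minorant. If some chord passes strictly
below the point at j, the chord of least height at j supports the sequence; otherwise the line
through that point with the least slope to the right does. Superlinear growth makes these minima
attained. -/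
theorem exists_affine_contact {n : ℕ → ℝ} (hn : Tendsto (fun i : ℕ => n i / i) atTop atTop)
    (j : ℕ) :
    ∃ v σ : ℝ, (∀ i : ℕ, v + σ * ((i : ℝ) - j) ≤ n i) ∧
      (v = n j ∨ ∃ a b : ℕ, a < j ∧ j < b ∧ v + σ * ((a : ℝ) - j) = n a ∧
        v + σ * ((b : ℝ) - j) = n b) := by
  have hgrow : ∀ K σ : ℝ, ∀ᶠ i : ℕ in atTop, K + σ * i ≤ n i := by
    intro K σ
    filter_upwards [hn.eventually_ge_atTop (|K| + σ), eventually_ge_atTop 1] with i h1 h2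
    have h2 : (1 : ℝ) ≤ i := by exact_mod_cast h2
    rw [le_div_iff₀ (by linarith)] at h1
    nlinarith [le_abs_self K, abs_nonneg K]
  by_cases hex : ∃ a b : ℕ, a < j ∧ j < b ∧
      n a * ((b : ℝ) - j) + n b * ((j : ℝ) - a) < n j * ((b : ℝ) - a)
  · obtain ⟨a₀, b₀, ha₀, hb₀, hlt₀⟩ := hex
    -- Height at j of the chord joining a to b = j + 1 + m; this parametrization enforces b > j.
    let ch : ℕ → ℕ → ℝ := fun a m =>
      (n a * (((j + 1 + m : ℕ) : ℝ) - j) + n (j + 1 + m) * ((j : ℝ) - a)) /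
        (((j + 1 + m : ℕ) : ℝ) - a)
    have hmin : ∀ a, ∃ m, a < j → ∀ m', ch a m ≤ ch a m' := by
      intro a
      by_cases ha : a < j
      swap
      · exact ⟨0, fun h => absurd h ha⟩
      have haj : (a : ℝ) < j := by exact_mod_cast ha
      have ht : Tendsto (ch a) cofinite atTop := by
        rw [Nat.cofinite_eq_atTop, tendsto_atTop]
        intro K
        have h1 := (tendsto_add_atTop_nat (j + 1)).eventually
          (hgrow ((|K| * (j + 1) + |n a| * (j + 1)) / (j - a)) ((|K| + |n a|) / (j - a)))
        filter_upwards [h1] with m hm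
        have hbj : (0 : ℝ) < ((j + 1 + m : ℕ) : ℝ) - j := by push_cast; linarith
        have hba : (0 : ℝ) < ((j + 1 + m : ℕ) : ℝ) - a := by linarith
        rw [le_div_iff₀ hba]
        have hja : (0 : ℝ) < (j : ℝ) - a := by linarith
        rw [add_comm m (j + 1)] at hm
        have h2 := mul_le_mul_of_nonneg_right hm hja.le
        have h3 : (((|K| * (j + 1) + |n a| * (j + 1)) / (j - a)) +
            ((|K| + |n a|) / (j - a)) * ((j + 1 + m : ℕ) : ℝ)) * ((j : ℝ) - a) =
            (|K| * (j + 1) + |n a| * (j + 1)) + (|K| + |n a|) * ((j + 1 + m : ℕ) : ℝ) := by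
          field_simp
        rw [h3] at h2
        set b : ℝ := ((j + 1 + m : ℕ) : ℝ)
        have hb : 0 ≤ b := Nat.cast_nonneg _
        have ha' : (0 : ℝ) ≤ a := Nat.cast_nonneg _
        have hj' : (0 : ℝ) ≤ j := Nat.cast_nonneg _
        have h4 : K * (b - a) ≤ |K| * b :=
          (mul_le_mul_of_nonneg_right (le_abs_self K) hba.le).trans
            (mul_le_mul_of_nonneg_left (by linarith) (abs_nonneg K))
        have h5 : -(n a) * (b - j) ≤ |n a| * b :=
          (mul_le_mul_of_nonneg_right (neg_le_abs (n a)) hbj.le).trans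
            (mul_le_mul_of_nonneg_left (by linarith) (abs_nonneg _))
        have h6 : 0 ≤ |K| * (j + 1) + |n a| * (j + 1) := by positivity
        linarith
      obtain ⟨m, hm⟩ := ht.exists_forall_le
      exact ⟨m, fun _ => hm⟩
    choose m hm using hmin
    -- The right end is already optimal for each a, and only finitely many left ends remain.
    obtain ⟨a, ha, hamin⟩ := Finset.exists_min_image (Finset.range j) (fun a => ch a (m a))
      ⟨a₀, Finset.mem_range.2 ha₀⟩
    rw [Finset.mem_range] at ha
    set b := j + 1 + m a with hb
    have haj : (a : ℝ) < j := by exact_mod_cast ha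
    have hjb : (j : ℝ) < b := by exact_mod_cast (by omega : j < b)
    have hba : (0 : ℝ) < (b : ℝ) - a := by linarith
    set v := ch a (m a) with hv
    have hvd : v * ((b : ℝ) - a) = n a * ((b : ℝ) - j) + n b * ((j : ℝ) - a) := by
      rw [hv]; exact div_mul_cancel₀ _ hba.ne'
    have hall : ∀ a' b' : ℕ, a' < j → j < b' →
        v * ((b' : ℝ) - a') ≤ n a' * ((b' : ℝ) - j) + n b' * ((j : ℝ) - a') := by
      intro a' b' ha' hb'
      obtain ⟨m', rfl⟩ := Nat.exists_eq_add_of_le (Nat.succ_le_of_lt hb')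
      have h1 : v ≤ ch a' m' := (hamin a' (Finset.mem_range.2 ha')).trans (hm a' ha' m')
      have h2 : (a' : ℝ) < j := by exact_mod_cast ha'
      have h3 : (j : ℝ) < (j + 1 + m' : ℕ) := by exact_mod_cast hb'
      exact (le_div_iff₀ (by linarith)).1 h1
    have hvj : v < n j := by
      have h1 := hall a₀ b₀ ha₀ hb₀
      have h2 : (a₀ : ℝ) < j := by exact_mod_cast ha₀
      have h3 : (j : ℝ) < b₀ := by exact_mod_cast hb₀
      exact lt_of_mul_lt_mul_right (h1.trans_lt hlt₀) (by linarith)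
    set σ := (n b - n a) / ((b : ℝ) - a) with hσ
    have hσd : σ * ((b : ℝ) - a) = n b - n a := div_mul_cancel₀ _ hba.ne'
    have hva : v + σ * ((a : ℝ) - j) = n a := by
      have : (v + σ * ((a : ℝ) - j)) * ((b : ℝ) - a) = n a * ((b : ℝ) - a) := by
        linear_combination hvd + ((a : ℝ) - j) * hσd
      exact mul_right_cancel₀ hba.ne' this
    have hvb : v + σ * ((b : ℝ) - j) = n b := by linarith
    refine ⟨v, σ, fun i => ?_, Or.inr ⟨a, b, ha, by omega, hva, hvb⟩⟩
    rcases lt_trichotomy i j with h | h | h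
    · have h1 := hall i b h (by omega)
      rw [← hvb] at h1
      have : (v + σ * ((i : ℝ) - j)) * ((b : ℝ) - j) ≤ n i * ((b : ℝ) - j) := by linarith
      exact le_of_mul_le_mul_right this (by linarith)
    · subst h; simpa using hvj.le
    · have h1 := hall a i ha h
      rw [← hva] at h1
      have : (v + σ * ((i : ℝ) - j)) * ((j : ℝ) - a) ≤ n i * ((j : ℝ) - a) := by linarith
      exact le_of_mul_le_mul_right this (by linarith)
  · push Not at hex
    have ht : Tendsto (fun m : ℕ => (n (j + 1 + m) - n j) / (((j + 1 + m : ℕ) : ℝ) - j))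
        cofinite atTop := by
      rw [Nat.cofinite_eq_atTop, tendsto_atTop]
      intro K
      filter_upwards [(tendsto_add_atTop_nat (j + 1)).eventually (hgrow (n j - K * j) K)] with m hm
      rw [add_comm m (j + 1)] at hm
      rw [le_div_iff₀ (by push_cast; linarith)]
      linarith
    obtain ⟨m, hm⟩ := ht.exists_forall_le
    set b := j + 1 + m with hb
    have hjb : (j : ℝ) < b := by exact_mod_cast (by omega : j < b)
    set σ := (n b - n j) / ((b : ℝ) - j) with hσ
    have hσd : σ * ((b : ℝ) - j) = n b - n j := div_mul_cancel₀ _ (by linarith)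
    refine ⟨n j, σ, fun i => ?_, Or.inl rfl⟩
    rcases lt_trichotomy i j with h | h | h
    · have h1 := hex i b h (by omega)
      have : (n j + σ * ((i : ℝ) - j)) * ((b : ℝ) - j) ≤ n i * ((b : ℝ) - j) := by
        have h2 : n b = n j + σ * ((b : ℝ) - j) := by linarith
        rw [h2] at h1
        linarith
      exact le_of_mul_le_mul_right this (by linarith)
    · subst h; simp
    · obtain ⟨m', rfl⟩ := Nat.exists_eq_add_of_le (Nat.succ_le_of_lt h)
      have h3 : (j : ℝ) < (j + 1 + m' : ℕ) := by exact_mod_cast h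
      have := (le_div_iff₀ (by linarith)).1 (hm m')
      simp only [Nat.succ_eq_add_one] at *
      linarith

theorem exists_geometric_contact {N : ℕ → ℝ} (hpos : ∀ i, 0 < N i)
    (hN : Tendsto (fun i : ℕ => N i ^ (1 / (i : ℝ))) atTop atTop) (j : ℕ) :
    ∃ c t : ℝ, 0 < c ∧ 0 < t ∧ (∀ i, c * t ^ i ≤ N i) ∧
      (c * t ^ j = N j ∨ ∃ a b, a < j ∧ j < b ∧ c * t ^ a = N a ∧ c * t ^ b = N b) := by
  have hlog : Tendsto (fun i : ℕ => Real.log (N i) / i) atTop atTop := by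
    refine (Real.tendsto_log_atTop.comp hN).congr fun i => ?_
    rw [Function.comp, Real.log_rpow (hpos i)]; ring
  obtain ⟨v, σ, hle, hc⟩ := exists_affine_contact hlog j
  have hexp : ∀ i : ℕ, Real.exp (v - σ * j) * Real.exp σ ^ i = Real.exp (v + σ * ((i : ℝ) - j)) := by
    intro i
    rw [← Real.exp_nat_mul, ← Real.exp_add]; congr 1; ring
  refine ⟨Real.exp (v - σ * j), Real.exp σ, Real.exp_pos _, Real.exp_pos _, fun i => ?_, ?_⟩
  · rw [hexp, ← Real.le_log_iff_exp_le (hpos i)]; exact hle i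
  · rcases hc with h | ⟨a, b, ha, hb, h1, h2⟩
    · left; rw [hexp, h, sub_self, mul_zero, add_zero, Real.exp_log (hpos j)]
    · right
      refine ⟨a, b, ha, hb, ?_, ?_⟩
      · rw [hexp, h1, Real.exp_log (hpos a)]
      · rw [hexp, h2, Real.exp_log (hpos b)]

theorem le_lcMinorant {N L : ℕ → ℝ} (hpos : ∀ i, 0 < L i) (hL : LogConvex L)
    (hle : ∀ i, L i ≤ N i) (j : ℕ) : L j ≤ lcMinorant N j := by
  refine le_csSup ⟨N j, ?_⟩ ⟨L, hpos, hL, hle, rfl⟩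
  rintro x ⟨L', -, -, h, rfl⟩
  exact h j

theorem geometric_le_lcMinorant {N : ℕ → ℝ} {c t : ℝ} (hc : 0 < c) (ht : 0 < t)
    (hle : ∀ i, c * t ^ i ≤ N i) (j : ℕ) : c * t ^ j ≤ lcMinorant N j :=
  le_lcMinorant (L := fun i => c * t ^ i) (fun i => by positivity)
    (fun i => le_of_eq (by ring)) hle j

section lcMinorant

variable {N : ℕ → ℝ} (hpos : ∀ i, 0 < N i)
  (hN : Tendsto (fun i : ℕ => N i ^ (1 / (i : ℝ))) atTop atTop)

include hpos hN

theorem lcMinorant_le_of_forall {j : ℕ} {x : ℝ}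
    (h : ∀ L : ℕ → ℝ, (∀ i, 0 < L i) → LogConvex L → (∀ i, L i ≤ N i) → L j ≤ x) :
    lcMinorant N j ≤ x := by
  obtain ⟨c, t, hc, ht, hle, -⟩ := exists_geometric_contact hpos hN j
  refine csSup_le ⟨c * t ^ j, fun i => c * t ^ i, fun i => by positivity,
    fun i => le_of_eq (by ring), hle, rfl⟩ ?_
  rintro x ⟨L, h1, h2, h3, rfl⟩
  exact h L h1 h2 h3

theorem lcMinorant_le (j : ℕ) : lcMinorant N j ≤ N j :=
  lcMinorant_le_of_forall hpos hN fun _ _ _ h => h j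

theorem lcMinorant_pos (j : ℕ) : 0 < lcMinorant N j := by
  obtain ⟨c, t, hc, ht, hle, -⟩ := exists_geometric_contact hpos hN j
  exact lt_of_lt_of_le (by positivity) (geometric_le_lcMinorant hc ht hle j)

theorem lcMinorant_zero : lcMinorant N 0 = N 0 := by
  obtain ⟨c, t, hc, ht, hle, h | ⟨a, b, ha, -⟩⟩ := exists_geometric_contact hpos hN 0
  · exact le_antisymm (lcMinorant_le hpos hN 0) (h ▸ geometric_le_lcMinorant hc ht hle 0)
  · omega

/-- A pointwise supremum of log-convex sequences is log-convex: each competitor satisfies the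
midpoint inequality with its neighbours replaced by the suprema. -/
theorem logConvex_lcMinorant : LogConvex (lcMinorant N) := by
  intro j
  have h0 := lcMinorant_pos hpos hN
  have h1 : lcMinorant N (j + 1) ≤ √(lcMinorant N j * lcMinorant N (j + 2)) := by
    refine lcMinorant_le_of_forall hpos hN fun L hL hlc hle => Real.le_sqrt_of_sq_le ?_
    have h2 := le_lcMinorant hL hlc hle
    exact (hlc j).trans (mul_le_mul (h2 j) (h2 (j + 2)) (hL _).le (h0 _).le)
  calc lcMinorant N (j + 1) ^ 2 ≤ √(lcMinorant N j * lcMinorant N (j + 2)) ^ 2 := by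
        have := (h0 (j + 1)).le
        gcongr
    _ = _ := Real.sq_sqrt (mul_nonneg (h0 _).le (h0 _).le)

theorem lcMinorant_mono {N' : ℕ → ℝ} (h : ∀ i, N i ≤ N' i) (j : ℕ) :
    lcMinorant N j ≤ lcMinorant N' j :=
  lcMinorant_le_of_forall hpos hN fun _ h1 h2 h3 => le_lcMinorant h1 h2 (fun i => (h3 i).trans (h i)) j

end lcMinorant

/-- Equivalent to L_j^(j+1) ≤ L_{j+1}^j, which follows by induction from log-convexity, starting at
L_0 = 1. -/
theorem LogConvex.rpow_inv_mono {L : ℕ → ℝ} (hpos : ∀ i, 0 < L i) (h0 : L 0 = 1)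
    (hL : LogConvex L) {j k : ℕ} (hj : 1 ≤ j) (hjk : j ≤ k) :
    L j ^ (1 / (j : ℝ)) ≤ L k ^ (1 / (k : ℝ)) := by
  have hpow : ∀ j, L j ^ (j + 1) ≤ L (j + 1) ^ j := by
    intro j
    induction j with
    | zero => simp [h0]
    | succ j ih =>
      have h1 : (L (j + 1) ^ 2) ^ (j + 1) ≤ (L j * L (j + 2)) ^ (j + 1) :=
        pow_le_pow_left₀ (by positivity) (hL j) _
      have h2 : L (j + 1) ^ j * L (j + 1) ^ (j + 2) ≤ L (j + 1) ^ j * L (j + 2) ^ (j + 1) := by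
        calc _ = (L (j + 1) ^ 2) ^ (j + 1) := by ring
          _ ≤ L j ^ (j + 1) * L (j + 2) ^ (j + 1) := by rw [← mul_pow]; exact h1
          _ ≤ _ := mul_le_mul_of_nonneg_right ih (pow_pos (hpos _) _).le
      exact le_of_mul_le_mul_left h2 (pow_pos (hpos _) _)
  induction k, hjk using Nat.le_induction with
  | base => exact le_rfl
  | succ k hk ih =>
    refine ih.trans ?_
    have hk0 : (0 : ℝ) < k := by exact_mod_cast (by omega : 0 < k)
    have h1 : (L k ^ (k + 1)) ^ (1 / ((k : ℝ) * (k + 1))) ≤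
        (L (k + 1) ^ k) ^ (1 / ((k : ℝ) * (k + 1))) :=
      Real.rpow_le_rpow (pow_pos (hpos _) _).le (hpow k) (by positivity)
    rw [← Real.rpow_natCast, ← Real.rpow_natCast, ← Real.rpow_mul (hpos _).le,
      ← Real.rpow_mul (hpos _).le] at h1
    have e1 : ((k + 1 : ℕ) : ℝ) * (1 / ((k : ℝ) * (k + 1))) = 1 / (k : ℝ) := by
      push_cast; field_simp
    have e2 : (k : ℝ) * (1 / ((k : ℝ) * (k + 1))) = 1 / ((k + 1 : ℕ) : ℝ) := by
      push_cast; field_simp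
    rwa [e1, e2] at h1

/-! ### The regularized matrix -/

theorem gevreyBar_eq_exp (s : ℝ) (j : ℕ) :
    gevreyBar s j = Real.exp (s * ((j : ℝ) * Real.log j)) := by
  rcases Nat.eq_zero_or_pos j with rfl | hj
  · simp [gevreyBar]
  · have : (0 : ℝ) < j := by exact_mod_cast hj
    rw [gevreyBar, Real.rpow_def_of_pos this]; congr 1; ring

theorem gevreyBar_pos (s : ℝ) (j : ℕ) : 0 < gevreyBar s j := by
  rw [gevreyBar_eq_exp]; exact Real.exp_pos _

theorem gevreyBar_zero (s : ℝ) : gevreyBar s 0 = 1 := by simp [gevreyBar]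

theorem gevreyBar_mul (s t : ℝ) (j : ℕ) : gevreyBar s j * gevreyBar t j = gevreyBar (s + t) j := by
  simp only [gevreyBar_eq_exp]; rw [← Real.exp_add]; congr 1; ring

theorem gevreyBar_mul_cancel (α : ℝ) (j : ℕ) : gevreyBar (α - 1) j * gevreyBar (1 - α) j = 1 := by
  rw [gevreyBar_mul, gevreyBar_eq_exp]; simp

/-- The sequence `j ^ ((1 - α) j) M_j`. -/
noncomputable def twisted (M : SeqFamily) (α : ℝ) (p : Set.Ioi (0 : ℝ)) (j : ℕ) : ℝ := gevreyBar (1 - α) j * M p j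

theorem regularized_eq (M : SeqFamily) (α : ℝ) (p : Set.Ioi (0 : ℝ)) (j : ℕ) :
    regularized M α p j = gevreyBar (α - 1) j * lcMinorant (twisted M α p) j := rfl

/-- A weight matrix together with an opening for which the regularized matrix is well-behaved. -/
structure IsRegularizable (M : SeqFamily) (α : ℝ) : Prop where
  weight : IsWeightMatrix M
  pos : 0 < α
  le_one : α ≤ 1
  lim : ∀ p, Tendsto (fun j : ℕ => (twisted M α p j) ^ (1 / (j : ℝ))) atTop atTop

namespace IsRegularizable

variable {M : SeqFamily} {α : ℝ} (h : IsRegularizable M α)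

include h

theorem twisted_pos (p : Set.Ioi (0 : ℝ)) (j : ℕ) : 0 < twisted M α p j :=
  mul_pos (gevreyBar_pos _ _) (h.weight.pos p j)

theorem lc_pos (p : Set.Ioi (0 : ℝ)) (j : ℕ) : 0 < lcMinorant (twisted M α p) j :=
  lcMinorant_pos (h.twisted_pos p) (h.lim p) j

theorem lc_zero (p : Set.Ioi (0 : ℝ)) : lcMinorant (twisted M α p) 0 = 1 := by
  rw [lcMinorant_zero (h.twisted_pos p) (h.lim p), twisted, gevreyBar_zero, h.weight.zero, one_mul]

theorem lc_logConvex (p : Set.Ioi (0 : ℝ)) : LogConvex (lcMinorant (twisted M α p)) :=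
  logConvex_lcMinorant (h.twisted_pos p) (h.lim p)

theorem regularized_pos (p : Set.Ioi (0 : ℝ)) (j : ℕ) : 0 < regularized M α p j :=
  mul_pos (gevreyBar_pos _ _) (h.lc_pos p j)

theorem regularized_zero (p : Set.Ioi (0 : ℝ)) : regularized M α p 0 = 1 := by
  rw [regularized_eq, gevreyBar_zero, h.lc_zero, one_mul]

theorem regularized_le (p : Set.Ioi (0 : ℝ)) (j : ℕ) : regularized M α p j ≤ M p j := by
  have := mul_le_mul_of_nonneg_left (lcMinorant_le (h.twisted_pos p) (h.lim p) j)
    (gevreyBar_pos (α - 1) j).le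
  rw [regularized_eq]
  refine this.trans_eq ?_
  rw [twisted, ← mul_assoc, gevreyBar_mul_cancel, one_mul]

theorem regularized_mono {p q : Set.Ioi (0 : ℝ)} (hpq : p ≤ q) (j : ℕ) :
    regularized M α p j ≤ regularized M α q j :=
  mul_le_mul_of_nonneg_left (lcMinorant_mono (h.twisted_pos p) (h.lim p)
    (fun i => mul_le_mul_of_nonneg_left (h.weight.mono p q hpq i) (gevreyBar_pos _ _).le) j)
    (gevreyBar_pos _ _).le

theorem check_pos (p : Set.Ioi (0 : ℝ)) (j : ℕ) : 0 < check (regularized M α p) j :=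
  div_pos (h.regularized_pos p j) (by exact_mod_cast j.factorial_pos)

theorem check_zero (p : Set.Ioi (0 : ℝ)) : check (regularized M α p) 0 = 1 := by
  simp [check, h.regularized_zero]

theorem check_mono {p q : Set.Ioi (0 : ℝ)} (hpq : p ≤ q) (j : ℕ) :
    check (regularized M α p) j ≤ check (regularized M α q) j := by
  have := h.regularized_mono hpq j
  unfold check
  gcongr

/-- The roots of `M̌_j` grow at least up to a constant between `j` and `2 j`. -/
theorem check_rpow_le (p : Set.Ioi (0 : ℝ)) {j k : ℕ} (hj : 1 ≤ j) (hjk : j ≤ k)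
    (hk : k ≤ 2 * j) :
    check (regularized M α p) j ^ (1 / (j : ℝ)) ≤
      4 * Real.exp 1 * check (regularized M α p) k ^ (1 / (k : ℝ)) := by
  have hform : ∀ i : ℕ, 1 ≤ i → check (regularized M α p) i ^ (1 / (i : ℝ)) =
      (i : ℝ) ^ (α - 1) * lcMinorant (twisted M α p) i ^ (1 / (i : ℝ)) /
        (i.factorial : ℝ) ^ (1 / (i : ℝ)) := by
    intro i hi
    have hi0 : (0 : ℝ) < i := by exact_mod_cast hi
    rw [check, regularized_eq, Real.div_rpow
      (mul_pos (gevreyBar_pos _ _) (h.lc_pos p i)).le (by positivity),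
      Real.mul_rpow (gevreyBar_pos _ _).le (h.lc_pos p i).le, gevreyBar, ← Real.rpow_mul hi0.le]
    congr 3
    field_simp
  have hj0 : (0 : ℝ) < j := by exact_mod_cast hj
  have hk0 : (0 : ℝ) < k := by exact_mod_cast hj.trans hjk
  have hjk' : (j : ℝ) ≤ k := by exact_mod_cast hjk
  have hk' : (k : ℝ) ≤ 2 * j := by exact_mod_cast hk
  rw [hform j hj, hform k (hj.trans hjk)]
  -- The root of the minorant increases. For k ≤ 2j the power j^(α-1) loses at most a factor 2 and
  -- the root of the factorial at most 2e, which together give 4e.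
  have h1 := LogConvex.rpow_inv_mono (h.lc_pos p) (h.lc_zero p) (h.lc_logConvex p) hj hjk
  have h2 : (j : ℝ) ^ (α - 1) ≤ 2 * (k : ℝ) ^ (α - 1) := by
    have e : (j : ℝ) ^ (α - 1) = (k : ℝ) ^ (α - 1) * ((k : ℝ) / j) ^ (1 - α) := by
      have : ((k : ℝ) / j) ^ (1 - α) = ((j : ℝ) / k) ^ (α - 1) := by
        rw [← inv_div, Real.inv_rpow (by positivity), ← Real.rpow_neg (by positivity), neg_sub]
      rw [this, ← Real.mul_rpow (by positivity) (by positivity)]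
      congr 1; field_simp
    have h3 : ((k : ℝ) / j) ^ (1 - α) ≤ 2 := by
      have h4 : (1 : ℝ) ≤ (k : ℝ) / j := by rwa [one_le_div hj0]
      have h5 : (k : ℝ) / j ≤ 2 := by rwa [div_le_iff₀ hj0]
      calc ((k : ℝ) / j) ^ (1 - α) ≤ ((k : ℝ) / j) ^ (1 : ℝ) :=
            Real.rpow_le_rpow_of_exponent_le h4 (by linarith [h.pos])
        _ ≤ 2 := by rwa [Real.rpow_one]
    rw [e, mul_comm 2]
    gcongr
  have h3 : (k.factorial : ℝ) ^ (1 / (k : ℝ)) ≤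
      2 * Real.exp 1 * (j.factorial : ℝ) ^ (1 / (j : ℝ)) := by
    have a1 : (k.factorial : ℝ) ^ (1 / (k : ℝ)) ≤ k := by
      rw [one_div]
      refine (Real.rpow_le_rpow (by positivity)
        (by exact_mod_cast Nat.factorial_le_pow k : (k.factorial : ℝ) ≤ (k : ℝ) ^ k)
        (by positivity)).trans_eq ?_
      exact Real.pow_rpow_inv_natCast hk0.le (by omega)
    have a2 : (j : ℝ) / Real.exp 1 ≤ (j.factorial : ℝ) ^ (1 / (j : ℝ)) := by
      rw [one_div]
      refine le_trans (le_of_eq ?_) (Real.rpow_le_rpow (by positivity)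
        (pow_div_exp_le_factorial j) (by positivity))
      exact (Real.pow_rpow_inv_natCast (by positivity) (by omega)).symm
    rw [div_le_iff₀ (Real.exp_pos _)] at a2
    linarith
  have hx : 0 < lcMinorant (twisted M α p) j ^ (1 / (j : ℝ)) := Real.rpow_pos_of_pos (h.lc_pos p j) _
  have hf1 : 0 < (j.factorial : ℝ) ^ (1 / (j : ℝ)) :=
    Real.rpow_pos_of_pos (by exact_mod_cast j.factorial_pos) _
  have hf2 : 0 < (k.factorial : ℝ) ^ (1 / (k : ℝ)) :=
    Real.rpow_pos_of_pos (by exact_mod_cast k.factorial_pos) _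
  rw [div_le_iff₀ hf1]
  have hkp : 0 < (k : ℝ) ^ (α - 1) := by positivity
  have hy := hx.trans_le h1
  calc _ ≤ 2 * (k : ℝ) ^ (α - 1) * lcMinorant (twisted M α p) k ^ (1 / (k : ℝ)) := by gcongr
    _ = 2 * ((k : ℝ) ^ (α - 1) * lcMinorant (twisted M α p) k ^ (1 / (k : ℝ)) /
          (k.factorial : ℝ) ^ (1 / (k : ℝ))) * (k.factorial : ℝ) ^ (1 / (k : ℝ)) := by
      field_simp
    _ ≤ 2 * ((k : ℝ) ^ (α - 1) * lcMinorant (twisted M α p) k ^ (1 / (k : ℝ)) /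
          (k.factorial : ℝ) ^ (1 / (k : ℝ))) *
          (2 * Real.exp 1 * (j.factorial : ℝ) ^ (1 / (j : ℝ))) := by gcongr
    _ = _ := by ring

/-- To verify the root almost increasing property, it suffices to compare indices one of which is
a multiple of the other. -/
theorem rai_of_multiples
    (hmul : ∀ p, ∃ C : ℝ, 0 < C ∧ ∃ q, ∀ j l : ℕ, 1 ≤ j → 1 ≤ l →
      check (regularized M α p) j ^ l ≤ C ^ (l * j) * check (regularized M α q) (l * j)) :
    Rai (regularized M α) := by
  intro p
  obtain ⟨C, hC, q, hq⟩ := hmul p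
  refine ⟨C * (4 * Real.exp 1), by positivity, q, fun j k hj hjk => ?_⟩
  -- The integer quotient gives lj ≤ k ≤ 2lj: the hypothesis leads from j to lj, and `check_rpow_le`
  -- from lj to k.
  set l := k / j with hl
  have hl1 : 1 ≤ l := (Nat.one_le_div_iff (by omega)).2 hjk
  have hlk : l * j ≤ k := Nat.div_mul_le_self k j
  have hkl : k ≤ 2 * (l * j) := by
    have h1 := Nat.div_add_mod k j
    have h2 := Nat.mod_lt k (by omega : j > 0)
    have h3 : j ≤ l * j := Nat.le_mul_of_pos_left j hl1
    rw [mul_comm j, ← hl] at h1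
    omega
  have hlj1 : 1 ≤ l * j := Nat.mul_pos hl1 hj
  have hlj0 : (0 : ℝ) < (l * j : ℕ) := by exact_mod_cast hlj1
  have hj0 : (0 : ℝ) < j := by exact_mod_cast hj
  have hl0 : (0 : ℝ) < l := by exact_mod_cast hl1
  have h1 := Real.rpow_le_rpow (pow_pos (h.check_pos p j) l).le (hq j l hj hl1)
    (by positivity : 0 ≤ 1 / ((l * j : ℕ) : ℝ))
  rw [Real.mul_rpow (by positivity) (h.check_pos q _).le, one_div ((l * j : ℕ) : ℝ),
    Real.pow_rpow_inv_natCast hC.le (by omega), ← Real.rpow_natCast, ← Real.rpow_mul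
      (h.check_pos p j).le] at h1
  have e : (l : ℝ) * ((l * j : ℕ) : ℝ)⁻¹ = 1 / j := by push_cast; field_simp
  rw [e, ← one_div] at h1
  have h2 := h.check_rpow_le q hlj1 hlk hkl
  calc _ ≤ _ := h1
    _ ≤ C * (4 * Real.exp 1 * check (regularized M α q) k ^ (1 / (k : ℝ))) := by gcongr
    _ = _ := by ring

end IsRegularizable

/-! ### Passing from the estimates of `M` to those of the regularized matrix. -/

/-- The loss k log(n/k) in the interpolation inequality is paid by the convexity gap of x log x
between a and a + n, up to (a+k) log 2, which only contributes a geometric factor. -/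
theorem mul_log_add_le {a k n : ℝ} (ha : 0 ≤ a) (hk : 0 < k) (hkn : k < n) :
    (a + k) * Real.log (a + k) + k * Real.log (n / k) ≤
      (1 - k / n) * (a * Real.log a) + k / n * ((a + n) * Real.log (a + n)) +
        (a + k) * Real.log 2 := by
  have hn : 0 < n := hk.trans hkn
  have h1 : (a + k) * Real.log (a + k) ≤
      a * Real.log a + k * Real.log k + (a + k) * Real.log 2 := by
    have h2 := Real.convexOn_mul_log.2 (Set.mem_Ici.2 ha) (Set.mem_Ici.2 hk.le)
      (by norm_num : (0 : ℝ) ≤ 1 / 2) (by norm_num : (0 : ℝ) ≤ 1 / 2) (by norm_num)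
    simp only [smul_eq_mul] at h2
    have h3 : 1 / 2 * a + 1 / 2 * k = (a + k) / 2 := by ring
    rw [h3, Real.log_div (by linarith) (by norm_num)] at h2
    linarith
  have h4 : k * Real.log (n / k) = k * Real.log n - k * Real.log k := by
    rw [Real.log_div hn.ne' hk.ne']; ring
  have h5 : k * Real.log n ≤ k * Real.log (a + n) :=
    mul_le_mul_of_nonneg_left (Real.log_le_log hn (by linarith)) hk.le
  have h6 : a * Real.log a ≤ a * Real.log (a + n) := by
    rcases ha.eq_or_lt with rfl | ha
    · simp
    · exact mul_le_mul_of_nonneg_left (Real.log_le_log ha (by linarith)) ha.le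
  have h7 : k / n * ((a + n) * Real.log (a + n)) =
      k / n * (a * Real.log (a + n)) + k * Real.log (a + n) := by field_simp
  have h8 : k / n * (a * Real.log a) ≤ k / n * (a * Real.log (a + n)) := by gcongr
  linarith

/-- Functions in the class of `M` on the sector satisfy the estimates of the regularized matrix. -/
theorem derivBound_regularized {M : SeqFamily} {α : ℝ} (h : IsRegularizable M α)
    {p : Set.Ioi (0 : ℝ)} {f : ℂ → ℂ} (hf : DifferentiableOn ℂ f (sector α))
    (hb : DerivBound (M p) (sector α) f) : DerivBound (regularized M α p) (sector α) f := by
  obtain ⟨H, hH, C', hC'⟩ := hb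
  have hMpos := h.weight.pos p
  set C := max C' 1 with hCdef
  have hC : 0 < C := lt_max_of_lt_right one_pos
  have hbd : ∀ z ∈ sector α, ∀ j : ℕ, ‖iteratedDeriv j f z‖ ≤ C * (H ^ j * M p j) :=
    fun z hz j => (hC' z hz j).trans
      (mul_le_mul_of_nonneg_right (le_max_left _ _) (mul_pos (pow_pos hH j) (hMpos j)).le)
  refine ⟨2 * Real.exp 3 * H, by positivity, 2 * C, fun z hz j => ?_⟩
  have he3 : (1 : ℝ) ≤ 2 * Real.exp 3 := by
    have := Real.one_le_exp (by norm_num : (0 : ℝ) ≤ 3)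
    linarith
  have hMN : ∀ i, M p i = gevreyBar (α - 1) i * twisted M α p i := fun i => by
    rw [twisted, ← mul_assoc, gevreyBar_mul_cancel, one_mul]
  obtain ⟨c, t, hc, ht, hle, hcontact⟩ := exists_geometric_contact (h.twisted_pos p) (h.lim p) j
  have hreg : gevreyBar (α - 1) j * (c * t ^ j) ≤ regularized M α p j :=
    mul_le_mul_of_nonneg_left (geometric_le_lcMinorant hc ht hle j) (gevreyBar_pos _ _).le
  suffices hs : ‖iteratedDeriv j f z‖ ≤
      2 * C * ((2 * Real.exp 3 * H) ^ j * (gevreyBar (α - 1) j * (c * t ^ j))) from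
    hs.trans (by gcongr)
  rcases hcontact with heq | ⟨a, b, haj, hjb, hca, hcb⟩
  · refine (hbd z hz j).trans ?_
    rw [heq, ← hMN]
    have h1 : H ^ j ≤ (2 * Real.exp 3 * H) ^ j := by
      rw [mul_pow]; exact le_mul_of_one_le_left (by positivity) (one_le_pow₀ he3)
    have := (hMpos j).le
    calc _ ≤ C * ((2 * Real.exp 3 * H) ^ j * M p j) := by gcongr
      _ ≤ _ := mul_le_mul_of_nonneg_right (by linarith) (by positivity)
  · have hS := isOpen_sector h.pos h.le_one
    -- With contacts a < j < b, interpolation is applied to the a-th derivative of f, between orders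
    -- 0 and n = b - a, at order K = j - a.
    obtain ⟨k, rfl⟩ := Nat.exists_eq_add_of_lt haj
    obtain ⟨m, rfl⟩ := Nat.exists_eq_add_of_lt hjb
    rw [show a + k + 1 + m + 1 = a + (k + m + 2) by ring] at hcb
    rw [show a + k + 1 = a + (k + 1) by ring] at *
    set n := k + m + 2 with hn
    set K := k + 1 with hK
    have hcomp : ∀ i, iteratedDeriv i (iteratedDeriv a f) = iteratedDeriv (a + i) f := by
      intro i
      rw [iteratedDeriv_eq_iterate, iteratedDeriv_eq_iterate, iteratedDeriv_eq_iterate,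
        ← Function.iterate_add_apply, add_comm a]
    have hKn : K < n := by omega
    have hfa : DifferentiableOn ℂ (iteratedDeriv a f) (sector α) := fun w hw =>
      (analyticAt_iteratedDeriv hS hf a hw).differentiableAt.differentiableWithinAt
    have hA : 0 < C * (H ^ a * M p a) := mul_pos hC (mul_pos (pow_pos hH _) (hMpos _))
    have hB : 0 < C * (H ^ (a + n) * M p (a + n)) :=
      mul_pos hC (mul_pos (pow_pos hH _) (hMpos _))
    have key := norm_iteratedDeriv_le_interpolation h.pos h.le_one hfa hA hB (by omega : 1 ≤ K) hKn
      (fun w hw => hbd w hw a) (fun w hw => by rw [hcomp]; exact hbd w hw (a + n)) hz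
    rw [hcomp] at key
    refine key.trans ?_
    have hK0 : (0 : ℝ) < K := by exact_mod_cast (by omega : 0 < K)
    have hn0 : (0 : ℝ) < n := by exact_mod_cast (by omega : 0 < n)
    have hKn' : (K : ℝ) < n := by exact_mod_cast hKn
    have ha0 : (0 : ℝ) ≤ a := Nat.cast_nonneg a
    have hpow : ∀ {x : ℝ}, 0 < x → ∀ i : ℕ, x ^ i = Real.exp (i * Real.log x) := by
      intro x hx i
      rw [mul_comm, Real.exp_mul, Real.exp_log hx, Real.rpow_natCast]
    -- At a contact index the logarithm of the bound is affine in i apart from the term (α-1) i log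
    -- i. Interpolation reproduces the affine part exactly, so only x log x has to be compared.
    have hval : ∀ i : ℕ, c * t ^ i = twisted M α p i →
        C * (H ^ i * M p i) = Real.exp (Real.log C + Real.log c + i * Real.log H + i * Real.log t +
          (α - 1) * ((i : ℝ) * Real.log i)) := by
      intro i hi
      rw [hMN, ← hi, gevreyBar_eq_exp, hpow hH, hpow ht]
      simp only [Real.exp_add, Real.exp_log hC, Real.exp_log hc]
      ring
    rw [hval a hca, hval (a + n) hcb, ← Real.exp_mul, ← Real.exp_mul,
      Real.rpow_def_of_pos (by positivity), gevreyBar_eq_exp, hpow (by positivity : 0 < 2 * Real.exp 3 * H),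
      hpow ht, Real.log_mul (by positivity) hH.ne', Real.log_mul (by norm_num) (Real.exp_pos _).ne',
      Real.log_exp]
    have hnum := mul_log_add_le ha0 hK0 hKn'
    have hρ : 0 ≤ 1 - α := by linarith [h.le_one]
    have hnum' := mul_le_mul_of_nonneg_left hnum hρ
    have hCc : C * c = Real.exp (Real.log C + Real.log c) := by
      rw [Real.exp_add, Real.exp_log hC, Real.exp_log hc]
    have hR : 2 * C * (Real.exp (((a + K : ℕ) : ℝ) * (Real.log 2 + 3 + Real.log H)) *
        (Real.exp ((α - 1) * (((a + K : ℕ) : ℝ) * Real.log ((a + K : ℕ) : ℝ))) *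
          (c * Real.exp (((a + K : ℕ) : ℝ) * Real.log t)))) =
        2 * Real.exp (Real.log C + Real.log c + ((a + K : ℕ) : ℝ) * (Real.log 2 + 3 + Real.log H) +
          (α - 1) * (((a + K : ℕ) : ℝ) * Real.log ((a + K : ℕ) : ℝ)) +
            ((a + K : ℕ) : ℝ) * Real.log t) := by
      simp only [Real.exp_add, Real.exp_log hC, Real.exp_log hc]
      ring
    rw [hR, mul_assoc, mul_assoc, ← Real.exp_add, ← Real.exp_add, ← Real.exp_add]
    gcongr 2 * Real.exp ?_
    push_cast
    have e1 : (K : ℝ) / n * n = K := div_mul_cancel₀ _ hn0.ne'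
    set θ : ℝ := (K : ℝ) / n with hθ
    set LH := Real.log H
    set Lt := Real.log t
    set LC := Real.log C
    set Lc := Real.log c
    have e2 : (1 - θ) * a + θ * (a + n) = a + K := by linear_combination e1
    have hl2 : 0 ≤ Real.log 2 := Real.log_nonneg (by norm_num)
    have h2a : (1 - α) * ((a + K) * Real.log 2) ≤ (a + K) * Real.log 2 := by
      refine mul_le_of_le_one_left (by positivity) (by linarith [h.pos])
    have e3 : (LC + Lc + a * LH + a * Lt + (α - 1) * (a * Real.log a)) * (1 - θ) +
        (LC + Lc + (a + n) * LH + (a + n) * Lt +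
          (α - 1) * ((a + n) * Real.log (a + n))) * θ =
        LC + Lc + (a + K) * LH + (a + K) * Lt - (1 - α) * ((1 - θ) * (a * Real.log a) +
          θ * ((a + n) * Real.log (a + n))) := by
      linear_combination (LH + Lt) * e2
    rw [e3]
    linarith

open MeasureTheory

/-! ### Inverse Laplace transform of powers -/

theorem integrableOn_rpow_mul_exp_neg {a b : ℝ} (ha : 0 < a) (hb : 0 < b) :
    IntegrableOn (fun t : ℝ => t ^ (a - 1) * Real.exp (-b * t)) (Set.Ioi 0) := by
  simpa using integrableOn_rpow_mul_exp_neg_mul_rpow (s := a - 1) (p := 1) (b := b) (by linarith)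
    one_pos hb

theorem norm_ofReal_mul_cexp_neg (c t : ℝ) (hc : 0 ≤ c) (r : ℂ) :
    ‖(c : ℂ) * Complex.exp (-(r * t))‖ = c * Real.exp (-r.re * t) := by
  rw [norm_mul, Complex.norm_real, Real.norm_of_nonneg hc, Complex.norm_exp]
  simp

theorem aestronglyMeasurable_rpow_mul_cexp (a : ℝ) (r : ℂ) :
    AEStronglyMeasurable (fun t : ℝ => ((t ^ (a - 1) : ℝ) : ℂ) * Complex.exp (-(r * t)))
      (volume.restrict (Set.Ioi 0)) := by
  refine Measurable.aestronglyMeasurable ?_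
  fun_prop

theorem integrableOn_rpow_mul_cexp {a : ℝ} (ha : 0 < a) {r : ℂ} (hr : 0 < r.re) :
    IntegrableOn (fun t : ℝ => ((t ^ (a - 1) : ℝ) : ℂ) * Complex.exp (-(r * t))) (Set.Ioi 0) := by
  refine (integrableOn_rpow_mul_exp_neg ha hr).mono' (aestronglyMeasurable_rpow_mul_cexp a r) ?_
  refine (ae_restrict_iff' measurableSet_Ioi).2 (Eventually.of_forall fun t ht => ?_)
  rw [norm_ofReal_mul_cexp_neg _ _ (Real.rpow_nonneg (le_of_lt ht) _)]

theorem differentiableAt_laplace_rpow {a : ℝ} (ha : 0 < a) {r : ℂ} (hr : 0 < r.re) :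
    DifferentiableAt ℂ (fun r : ℂ =>
      ∫ t in Set.Ioi (0 : ℝ), ((t ^ (a - 1) : ℝ) : ℂ) * Complex.exp (-(r * t))) r := by
  have hb : 0 < r.re / 2 := by linarith
  refine (hasDerivAt_integral_of_dominated_loc_of_deriv_le (μ := volume.restrict (Set.Ioi 0))
    (s := Metric.ball r (r.re / 2))
    (F' := fun (r : ℂ) (t : ℝ) => ((t ^ (a - 1) : ℝ) : ℂ) * (Complex.exp (-(r * t)) * (-t)))
    (bound := fun t => t ^ (a + 1 - 1) * Real.exp (-(r.re / 2) * t))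
    (Metric.ball_mem_nhds _ hb) ?_ ?_ ?_ ?_ ?_ ?_).2.differentiableAt
  · exact Eventually.of_forall fun r => aestronglyMeasurable_rpow_mul_cexp a r
  · exact integrableOn_rpow_mul_cexp ha hr
  · refine Measurable.aestronglyMeasurable ?_
    fun_prop
  · refine (ae_restrict_iff' measurableSet_Ioi).2 (Eventually.of_forall fun t ht s hs => ?_)
    have ht : 0 < t := ht
    have hs : ‖s - r‖ < r.re / 2 := by simpa [dist_eq_norm] using hs
    have h1 : r.re / 2 ≤ s.re := by
      have := (Complex.abs_re_le_norm (s - r)).trans hs.le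
      rw [Complex.sub_re] at this
      linarith [(abs_le.1 this).1]
    rw [← mul_assoc, norm_mul, norm_ofReal_mul_cexp_neg _ _ (Real.rpow_nonneg ht.le _), norm_neg,
      Complex.norm_real, Real.norm_of_nonneg ht.le]
    have h2 : t ^ (a + 1 - 1) = t ^ (a - 1) * t := by
      rw [← Real.rpow_add_one ht.ne']; congr 1; ring
    rw [h2]
    have h3 : Real.exp (-s.re * t) ≤ Real.exp (-(r.re / 2) * t) := by
      rw [Real.exp_le_exp]; nlinarith
    have h4 : 0 ≤ t ^ (a - 1) := Real.rpow_nonneg ht.le _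
    calc _ ≤ t ^ (a - 1) * Real.exp (-(r.re / 2) * t) * t := by gcongr
      _ = _ := by ring
  · exact integrableOn_rpow_mul_exp_neg (by linarith) hb
  · refine Eventually.of_forall fun t s _ => ?_
    have h1 : HasDerivAt (fun s : ℂ => -(s * (t : ℂ))) (-(t : ℂ)) s := by
      simpa using ((hasDerivAt_id s).mul_const (t : ℂ)).fun_neg
    exact h1.cexp.const_mul _

/-- Both sides are holomorphic in the right half-plane and agree for positive r by the Gamma
integral, so the identity theorem applies. -/
theorem integral_rpow_mul_cexp {a : ℝ} (ha : 0 < a) {r : ℂ} (hr : 0 < r.re) :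
    ∫ t in Set.Ioi (0 : ℝ), ((t ^ (a - 1) : ℝ) : ℂ) * Complex.exp (-(r * t)) =
      r ^ (-(a : ℂ)) * (Real.Gamma a : ℂ) := by
  set U : Set ℂ := {r | 0 < r.re} with hU
  have hUo : IsOpen U := isOpen_lt continuous_const Complex.continuous_re
  have hL : AnalyticOnNhd ℂ (fun r : ℂ =>
      ∫ t in Set.Ioi (0 : ℝ), ((t ^ (a - 1) : ℝ) : ℂ) * Complex.exp (-(r * t))) U :=
    DifferentiableOn.analyticOnNhd
      (fun r hr => (differentiableAt_laplace_rpow ha hr).differentiableWithinAt) hUo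
  have hR : AnalyticOnNhd ℂ (fun r : ℂ => r ^ (-(a : ℂ)) * (Real.Gamma a : ℂ)) U :=
    DifferentiableOn.analyticOnNhd (fun r hr =>
      ((differentiableAt_id.cpow_const (Or.inl hr)).mul_const _).differentiableWithinAt) hUo
  have hreal : ∀ x : ℝ, 0 < x →
      ∫ t in Set.Ioi (0 : ℝ), ((t ^ (a - 1) : ℝ) : ℂ) * Complex.exp (-((x : ℂ) * t)) =
        (x : ℂ) ^ (-(a : ℂ)) * (Real.Gamma a : ℂ) := by
    intro x hx
    have h1 := Real.integral_rpow_mul_exp_neg_mul_Ioi ha hx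
    have h2 : ∀ t : ℝ, ((t ^ (a - 1) : ℝ) : ℂ) * Complex.exp (-((x : ℂ) * t)) =
        ((t ^ (a - 1) * Real.exp (-(x * t)) : ℝ) : ℂ) := by intro t; push_cast; rfl
    simp only [h2]
    rw [integral_complex_ofReal, h1, one_div, Real.inv_rpow hx.le, ← Real.rpow_neg hx.le]
    push_cast
    rw [Complex.ofReal_cpow hx.le]
    push_cast
    rfl
  refine hL.eqOn_of_preconnected_of_frequently_eq hR
    (convex_halfSpace_re_gt 0).isPreconnected (z₀ := 1) (by simp [hU]) ?_ hr
  have ht : Tendsto (fun x : ℝ => (x : ℂ)) (𝓝[≠] 1) (𝓝[≠] 1) := by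
    refine tendsto_nhdsWithin_iff.2 ⟨?_, ?_⟩
    · exact (Complex.continuous_ofReal.tendsto' 1 1 (by simp)).mono_left nhdsWithin_le_nhds
    · filter_upwards [self_mem_nhdsWithin] with x hx
      simpa using hx
  refine ht.frequently (Eventually.frequently ?_)
  filter_upwards [nhdsWithin_le_nhds (lt_mem_nhds (one_pos : (0 : ℝ) < 1))] with x hx
  exact hreal x hx

theorem norm_sq_add_mul_I (x y : ℝ) : ‖(x : ℂ) + y * Complex.I‖ ^ 2 = x ^ 2 + y ^ 2 := by
  rw [Complex.sq_norm, Complex.normSq_apply]; simp; ring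

theorem one_le_norm_add_mul_I {x : ℝ} (hx : 1 ≤ x) (y : ℝ) : x ≤ ‖(x : ℂ) + y * Complex.I‖ := by
  have := Complex.re_le_norm ((x : ℂ) + y * Complex.I)
  simpa using this

theorem add_mul_I_mem_slitPlane {x : ℝ} (hx : 1 ≤ x) (y : ℝ) :
    (x : ℂ) + y * Complex.I ∈ Complex.slitPlane := by
  rw [Complex.mem_slitPlane_iff]; left; simp; linarith

theorem add_mul_I_ne_zero {x : ℝ} (hx : 1 ≤ x) (y : ℝ) : (x : ℂ) + y * Complex.I ≠ 0 :=
  Complex.slitPlane_ne_zero (add_mul_I_mem_slitPlane hx y)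

theorem norm_inv_sq_le {x : ℝ} (hx : 1 ≤ x) (y : ℝ) :
    ‖(((x : ℂ) + y * Complex.I) ^ 2)⁻¹‖ ≤ (1 + y ^ 2)⁻¹ := by
  rw [norm_inv, norm_pow, norm_sq_add_mul_I]
  gcongr
  nlinarith

/-- The inversion formula for the Laplace transform of `t ^ (a - 1)`, evaluated at `t = 1`. -/
theorem integral_cexp_mul_cpow_neg {a : ℝ} (ha : 2 ≤ a) {x : ℝ} (hx : 1 ≤ x) :
    ∫ y : ℝ, Complex.exp ((x : ℂ) + y * Complex.I) * ((x : ℂ) + y * Complex.I) ^ (-(a : ℂ)) =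
      2 * Real.pi * ((Real.Gamma a : ℂ))⁻¹ := by
  have hπ := Real.pi_pos
  have hx0 : 0 < x := by linarith
  have hΓ : (Real.Gamma a : ℂ) ≠ 0 := by exact_mod_cast (Real.Gamma_pos_of_pos (by linarith)).ne'
  -- The Fourier transform of f is Γ(a)(x + 2πiξ)^(-a); Fourier inversion at t = 1 is the claim.
  set f : ℝ → ℂ := Set.indicator (Set.Ioi 0)
    (fun t : ℝ => ((t ^ (a - 1) : ℝ) : ℂ) * Complex.exp (-((x : ℂ) * t))) with hf
  have hfi : Integrable f := by
    rw [hf, integrable_indicator_iff measurableSet_Ioi]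
    exact integrableOn_rpow_mul_cexp (by linarith) (by simpa using hx0)
  have hfour : ∀ ξ : ℝ, FourierTransform.fourier f ξ =
      ((x : ℂ) + (2 * Real.pi * ξ : ℝ) * Complex.I) ^ (-(a : ℂ)) * (Real.Gamma a : ℂ) := by
    intro ξ
    rw [Real.fourier_real_eq_integral_exp_smul,
      ← integral_rpow_mul_cexp (by linarith : 0 < a) (by simpa using hx0)]
    rw [← integral_indicator measurableSet_Ioi]
    congr 1
    ext t
    rw [hf]
    simp only [Set.indicator, smul_eq_mul]
    split_ifs
    · rw [mul_left_comm, ← Complex.exp_add]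
      congr 2
      push_cast
      ring
    · simp
  -- Here a ≥ 2 is used: it makes the transform absolutely integrable.
  have hbound : ∀ y : ℝ, ‖((x : ℂ) + y * Complex.I) ^ (-(a : ℂ))‖ ≤ (1 + y ^ 2)⁻¹ := by
    intro y
    refine le_trans ?_ (norm_inv_sq_le hx y)
    rw [← Complex.ofReal_neg, Complex.norm_cpow_real, norm_inv, norm_pow,
      Real.rpow_neg (norm_nonneg _)]
    have h1 := hx.trans (one_le_norm_add_mul_I hx y)
    gcongr
    calc _ = ‖(x : ℂ) + y * Complex.I‖ ^ (2 : ℝ) := by norm_cast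
      _ ≤ _ := Real.rpow_le_rpow_of_exponent_le h1 ha
  have hcont : Continuous fun y : ℝ => ((x : ℂ) + y * Complex.I) ^ (-(a : ℂ)) :=
    Continuous.cpow (by fun_prop) continuous_const fun y => add_mul_I_mem_slitPlane hx y
  have hint : Integrable fun y : ℝ => ((x : ℂ) + y * Complex.I) ^ (-(a : ℂ)) :=
    integrable_inv_one_add_sq.mono' hcont.aestronglyMeasurable (Eventually.of_forall hbound)
  have hfouri : Integrable (FourierTransform.fourier f) := by
    have : FourierTransform.fourier f = fun ξ : ℝ =>
        ((x : ℂ) + (2 * Real.pi * ξ : ℝ) * Complex.I) ^ (-(a : ℂ)) * (Real.Gamma a : ℂ) :=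
      funext hfour
    rw [this]
    exact (hint.comp_mul_left' (by positivity)).mul_const _
  have hc1 : ContinuousAt f 1 := by
    have : f =ᶠ[𝓝 1] fun t : ℝ => ((t ^ (a - 1) : ℝ) : ℂ) * Complex.exp (-((x : ℂ) * t)) := by
      filter_upwards [lt_mem_nhds (one_pos : (0 : ℝ) < 1)] with t ht
      rw [hf, Set.indicator_of_mem (by exact ht)]
    refine ContinuousAt.congr ?_ this.symm
    refine ContinuousAt.mul ?_ (by fun_prop)
    exact Complex.continuous_ofReal.continuousAt.comp
      (Real.continuousAt_rpow_const _ _ (Or.inl one_ne_zero))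
  have hinv := hfi.fourierInv_fourier_eq hfouri hc1
  have hf1 : f 1 = Complex.exp (-(x : ℂ)) := by
    rw [hf, Set.indicator_of_mem (by simp)]; simp
  rw [hf1, Real.fourierInv_eq'] at hinv
  have hsub : ∫ v : ℝ, Complex.exp (((2 * Real.pi * inner ℝ v 1 : ℝ) : ℂ) * Complex.I) •
      FourierTransform.fourier f v = (2 * Real.pi : ℝ)⁻¹ • (∫ y : ℝ,
        Complex.exp (y * Complex.I) * ((x : ℂ) + y * Complex.I) ^ (-(a : ℂ)) *
          (Real.Gamma a : ℂ)) := by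
    have := Measure.integral_comp_mul_left (fun y : ℝ => Complex.exp (y * Complex.I) *
      ((x : ℂ) + y * Complex.I) ^ (-(a : ℂ)) * (Real.Gamma a : ℂ)) (2 * Real.pi)
    rw [abs_of_pos (by positivity)] at this
    rw [← this]
    congr 1
    ext v
    rw [hfour, smul_eq_mul]
    simp [mul_assoc]
  rw [hsub, integral_mul_const] at hinv
  have hexp : ∀ y : ℝ, Complex.exp ((x : ℂ) + y * Complex.I) *
      ((x : ℂ) + y * Complex.I) ^ (-(a : ℂ)) = Complex.exp x * (Complex.exp (y * Complex.I) *
        ((x : ℂ) + y * Complex.I) ^ (-(a : ℂ))) := by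
    intro y; rw [Complex.exp_add]; ring
  simp only [hexp]
  rw [integral_const_mul]
  have hπC : (2 * Real.pi : ℂ) ≠ 0 := by exact_mod_cast (by positivity : (2 * Real.pi : ℝ) ≠ 0)
  rw [Complex.real_smul, Complex.exp_neg] at hinv
  push_cast at hinv
  have hex : Complex.exp (x : ℂ) ≠ 0 := Complex.exp_ne_zero _
  set J : ℂ := ∫ y : ℝ, Complex.exp (y * Complex.I) * ((x : ℂ) + y * Complex.I) ^ (-(a : ℂ))
  calc Complex.exp x * J = Complex.exp x * (2 * Real.pi) * (Real.Gamma a : ℂ)⁻¹ *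
        ((2 * Real.pi : ℂ)⁻¹ * (J * (Real.Gamma a : ℂ))) := by field_simp
    _ = _ := by rw [hinv]; field_simp

/-! ### A Wright function, bounded on a sector -/

/-- The integrand of the Bromwich integral for the `j`-th derivative of the Wright function. -/
noncomputable def wrightKernel (ρ : ℝ) (j : ℕ) (x : ℝ) (z : ℂ) (y : ℝ) : ℂ :=
  (-(((x : ℂ) + y * Complex.I) ^ (-(ρ : ℂ)))) ^ j *
    (Complex.exp ((x : ℂ) + y * Complex.I - z * ((x : ℂ) + y * Complex.I) ^ (-(ρ : ℂ))) *
      (((x : ℂ) + y * Complex.I) ^ 2)⁻¹)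

/-- The `j`-th derivative of the entire function `∑ (-z) ^ n / (n! Γ(ρ n + 2))`. -/
noncomputable def wright (ρ : ℝ) (j : ℕ) (z : ℂ) : ℂ :=
  (2 * Real.pi : ℂ)⁻¹ * ∫ y : ℝ, wrightKernel ρ j 1 z y

section

variable {ρ x : ℝ} (hρ : 0 ≤ ρ) (hx : 1 ≤ x)

include hx

theorem continuous_add_mul_I_cpow (ρ : ℝ) :
    Continuous fun y : ℝ => ((x : ℂ) + y * Complex.I) ^ (-(ρ : ℂ)) :=
  Continuous.cpow (by fun_prop) continuous_const fun y => add_mul_I_mem_slitPlane hx y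

theorem continuous_inv_sq : Continuous fun y : ℝ => (((x : ℂ) + y * Complex.I) ^ 2)⁻¹ :=
  Continuous.inv₀ (by fun_prop) fun y => pow_ne_zero 2 (add_mul_I_ne_zero hx y)

theorem continuous_wrightKernel (ρ : ℝ) (j : ℕ) (z : ℂ) : Continuous (wrightKernel ρ j x z) := by
  have h1 := continuous_add_mul_I_cpow hx ρ
  have h2 := continuous_inv_sq hx
  unfold wrightKernel
  fun_prop

include hρ

theorem norm_add_mul_I_cpow_le (y : ℝ) : ‖((x : ℂ) + y * Complex.I) ^ (-(ρ : ℂ))‖ ≤ x ^ (-ρ) := by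
  rw [← Complex.ofReal_neg, Complex.norm_cpow_real]
  exact Real.rpow_le_rpow_of_nonpos (by linarith) (one_le_norm_add_mul_I hx y) (by linarith)

theorem norm_add_mul_I_cpow_le_one (y : ℝ) : ‖((x : ℂ) + y * Complex.I) ^ (-(ρ : ℂ))‖ ≤ 1 :=
  (norm_add_mul_I_cpow_le hρ hx y).trans (Real.rpow_le_one_of_one_le_of_nonpos hx (by linarith))

theorem norm_wrightKernel_le (j : ℕ) (z : ℂ) (y : ℝ) :
    ‖wrightKernel ρ j x z y‖ ≤ (x ^ (-ρ)) ^ j *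
      (Real.exp (x - (z * ((x : ℂ) + y * Complex.I) ^ (-(ρ : ℂ))).re) * (1 + y ^ 2)⁻¹) := by
  unfold wrightKernel
  rw [norm_mul, norm_mul, norm_pow, norm_neg, Complex.norm_exp]
  have h1 := norm_add_mul_I_cpow_le hρ hx y
  have h2 := norm_inv_sq_le hx y
  have h3 : ((x : ℂ) + y * Complex.I - z * ((x : ℂ) + y * Complex.I) ^ (-(ρ : ℂ))).re =
      x - (z * ((x : ℂ) + y * Complex.I) ^ (-(ρ : ℂ))).re := by
    rw [Complex.sub_re]; simp
  rw [h3]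
  gcongr

/-- Unlike the sharper form, this gives an integrable majorant locally uniform in z, needed for
termwise integration and differentiation. -/
theorem norm_wrightKernel_le' (j : ℕ) (z : ℂ) (y : ℝ) :
    ‖wrightKernel ρ j x z y‖ ≤ Real.exp (x + ‖z‖) * (1 + y ^ 2)⁻¹ := by
  refine (norm_wrightKernel_le hρ hx j z y).trans ?_
  have h1 : (x ^ (-ρ)) ^ j ≤ 1 :=
    pow_le_one₀ (by positivity) (Real.rpow_le_one_of_one_le_of_nonpos hx (by linarith))
  have h2 : -(z * ((x : ℂ) + y * Complex.I) ^ (-(ρ : ℂ))).re ≤ ‖z‖ := by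
    refine (neg_le_abs _).trans ((Complex.abs_re_le_norm _).trans ?_)
    rw [norm_mul]
    exact mul_le_of_le_one_right (norm_nonneg _) (norm_add_mul_I_cpow_le_one hρ hx y)
  refine (mul_le_of_le_one_left (by positivity) h1).trans ?_
  gcongr
  linarith

theorem integrable_wrightKernel (j : ℕ) (z : ℂ) : Integrable (wrightKernel ρ j x z) :=
  (integrable_inv_one_add_sq.const_mul _).mono' (continuous_wrightKernel hx ρ j z).aestronglyMeasurable
    (Eventually.of_forall (norm_wrightKernel_le' hρ hx j z))

/-- Expand exp(-z s^(-ρ)) in powers of z and integrate term by term with the inverse Laplace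
formula. The sum does not involve x, so the abscissa of the contour may be moved without a contour
argument. -/
theorem hasSum_integral_wrightKernel (j : ℕ) (z : ℂ) :
    HasSum (fun n : ℕ => (-1) ^ j * ((-z) ^ n / (n.factorial : ℂ)) *
      (2 * Real.pi * ((Real.Gamma (ρ * (j + n : ℕ) + 2) : ℝ) : ℂ)⁻¹))
      (∫ y : ℝ, wrightKernel ρ j x z y) := by
  set F : ℕ → ℝ → ℂ := fun n y => (-z) ^ n / (n.factorial : ℂ) * wrightKernel ρ (j + n) x 0 y *
    (-1) ^ n with hF
  have hFn : ∀ n y, F n y = (-1) ^ j * ((-z) ^ n / (n.factorial : ℂ)) *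
      (Complex.exp ((x : ℂ) + y * Complex.I) * ((x : ℂ) + y * Complex.I) ^
        (-((ρ * (j + n : ℕ) + 2 : ℝ) : ℂ))) := by
    intro n y
    have hne := add_mul_I_ne_zero hx y
    have e : ((x : ℂ) + y * Complex.I) ^ (-((ρ * (j + n : ℕ) + 2 : ℝ) : ℂ)) =
        (((x : ℂ) + y * Complex.I) ^ (-(ρ : ℂ))) ^ (j + n) * (((x : ℂ) + y * Complex.I) ^ 2)⁻¹ := by
      rw [← Complex.cpow_nat_mul, ← Complex.cpow_ofNat, ← Complex.cpow_neg, ← Complex.cpow_add _ _ hne]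
      congr 1; push_cast; ring
    rw [hF, e]
    simp only [wrightKernel, zero_mul, sub_zero]
    rw [neg_pow (((x : ℂ) + y * Complex.I) ^ (-(ρ : ℂ))), pow_add (-1 : ℂ) j n]
    have : ((-1 : ℂ) ^ n) * (-1) ^ n = 1 := by rw [← mul_pow]; simp
    linear_combination ((-z) ^ n / (n.factorial : ℂ) * (-1) ^ j *
      (((x : ℂ) + y * Complex.I) ^ (-(ρ : ℂ))) ^ (j + n) *
      Complex.exp ((x : ℂ) + y * Complex.I) * (((x : ℂ) + y * Complex.I) ^ 2)⁻¹) * this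
  have hnorm : ∀ n y, ‖F n y‖ ≤ ‖z‖ ^ n / (n.factorial : ℝ) *
      (Real.exp x * (1 + y ^ 2)⁻¹) := by
    intro n y
    rw [hF]
    simp only [norm_mul, norm_div, norm_pow, norm_neg, norm_one, one_pow, mul_one,
      Complex.norm_natCast]
    have := norm_wrightKernel_le' hρ hx (j + n) 0 y
    rw [norm_zero, add_zero] at this
    gcongr
  have hFi : ∀ n, Integrable (F n) := fun n =>
    ((integrable_wrightKernel hρ hx (j + n) 0).const_mul _).mul_const _
  have hsum : Summable fun n => ∫ y, ‖F n y‖ := by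
    refine Summable.of_nonneg_of_le (fun n => integral_nonneg fun y => norm_nonneg _)
      (fun n => (integral_mono (hFi n).norm
        ((integrable_inv_one_add_sq.const_mul _).const_mul _) (hnorm n)).trans_eq
        (integral_const_mul _ _)) ?_
    exact (Real.summable_pow_div_factorial ‖z‖).mul_right _
  have key := hasSum_integral_of_summable_integral_norm hFi hsum
  have hlim : ∀ y, ∑' n, F n y = wrightKernel ρ j x z y := by
    intro y
    set w := ((x : ℂ) + y * Complex.I) ^ (-(ρ : ℂ)) with hw
    have h1 : HasSum (fun n : ℕ => (-(z * w)) ^ n / (n.factorial : ℂ)) (Complex.exp (-(z * w))) := by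
      rw [Complex.exp_eq_exp_ℂ]
      exact NormedSpace.exp_series_hasSum_exp' (𝕂 := ℂ) (-(z * w)) |>.congr_fun (fun n => by
        rw [smul_eq_mul]; ring)
    have h2 := (h1.mul_left ((-w) ^ j * (Complex.exp ((x : ℂ) + y * Complex.I) *
      (((x : ℂ) + y * Complex.I) ^ 2)⁻¹))).tsum_eq
    rw [wrightKernel, ← hw, sub_eq_add_neg, Complex.exp_add]
    rw [show (-w) ^ j * (Complex.exp ((x : ℂ) + y * Complex.I) * Complex.exp (-(z * w)) *
      (((x : ℂ) + y * Complex.I) ^ 2)⁻¹) = (-w) ^ j * (Complex.exp ((x : ℂ) + y * Complex.I) *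
      (((x : ℂ) + y * Complex.I) ^ 2)⁻¹) * Complex.exp (-(z * w)) by ring, ← h2]
    refine tsum_congr fun n => ?_
    rw [hF]
    simp only [wrightKernel, zero_mul, sub_zero, ← hw]
    rw [pow_add, neg_pow w n, neg_pow z n, neg_pow (z * w) n, mul_pow]
    have : ((-1 : ℂ) ^ n) * (-1) ^ n = 1 := by rw [← mul_pow]; simp
    linear_combination ((-1) ^ n * z ^ n / (n.factorial : ℂ) * (-w) ^ j * w ^ n *
      Complex.exp ((x : ℂ) + y * Complex.I) * (((x : ℂ) + y * Complex.I) ^ 2)⁻¹) * this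
  simp only [hlim] at key
  refine key.congr_fun fun n => ?_
  simp only [hFn]
  rw [integral_const_mul, integral_cexp_mul_cpow_neg _ hx]
  have : (0 : ℝ) ≤ ρ * (j + n : ℕ) := by positivity
  linarith

theorem wright_eq (j : ℕ) (z : ℂ) :
    wright ρ j z = (2 * Real.pi : ℂ)⁻¹ * ∫ y : ℝ, wrightKernel ρ j x z y := by
  rw [wright, (hasSum_integral_wrightKernel hρ le_rfl j z).unique
    (hasSum_integral_wrightKernel hρ hx j z)]

end

theorem wright_zero {ρ : ℝ} (hρ : 0 ≤ ρ) (j : ℕ) :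
    wright ρ j 0 = (-1) ^ j * ((Real.Gamma (ρ * j + 2))⁻¹ : ℝ) := by
  have h1 := (hasSum_integral_wrightKernel hρ le_rfl j 0).unique (hasSum_single 0 fun n hn => by
    simp [hn])
  have hπC : (Real.pi : ℂ) ≠ 0 := by exact_mod_cast Real.pi_ne_zero
  rw [wright, h1]
  simp only [neg_zero, pow_zero, Nat.factorial_zero, Nat.cast_one, div_one, mul_one, add_zero]
  push_cast
  field_simp

theorem hasDerivAt_wright {ρ : ℝ} (hρ : 0 ≤ ρ) (j : ℕ) (z : ℂ) :
    HasDerivAt (wright ρ j) (wright ρ (j + 1) z) z := by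
  unfold wright
  refine HasDerivAt.const_mul _ ?_
  refine (hasDerivAt_integral_of_dominated_loc_of_deriv_le
    (s := Metric.ball z 1) (F := fun z y => wrightKernel ρ j 1 z y)
    (F' := fun z y => wrightKernel ρ (j + 1) 1 z y)
    (bound := fun y => Real.exp (1 + (‖z‖ + 1)) * (1 + y ^ 2)⁻¹)
    (Metric.ball_mem_nhds _ one_pos) ?_ ?_ ?_ ?_ ?_ ?_).2
  · exact Eventually.of_forall fun z => (continuous_wrightKernel le_rfl ρ j z).aestronglyMeasurable
  · exact integrable_wrightKernel hρ le_rfl j z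
  · exact (continuous_wrightKernel le_rfl ρ (j + 1) z).aestronglyMeasurable
  · refine Eventually.of_forall fun y s hs => ?_
    have hs : ‖s - z‖ < 1 := by simpa [dist_eq_norm] using hs
    have h1 : ‖s‖ ≤ ‖z‖ + 1 := by
      have := norm_le_norm_add_norm_sub' s z
      linarith
    refine (norm_wrightKernel_le' hρ le_rfl (j + 1) s y).trans ?_
    gcongr
  · exact integrable_inv_one_add_sq.const_mul _
  · refine Eventually.of_forall fun y s _ => ?_
    unfold wrightKernel
    set w := (((1 : ℝ) : ℂ) + y * Complex.I) ^ (-(ρ : ℂ))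
    have h1 : HasDerivAt (fun s : ℂ => ((1 : ℝ) : ℂ) + y * Complex.I - s * w) (-w) s := by
      simpa using ((hasDerivAt_id s).mul_const w).const_sub (((1 : ℝ) : ℂ) + y * Complex.I)
    refine ((h1.cexp.mul_const _).const_mul _).congr_deriv ?_
    ring

/-! ### Size of the derivatives of the Wright function on the sector and at the vertex. -/

/-- The power has argument at most (1-α)π/2 in modulus, and z less than απ/2, so the product stays
in the right half-plane. This removes the growth in z from the kernel. -/
theorem re_mul_cpow_nonneg {α : ℝ} (hα0 : 0 < α) (hα1 : α ≤ 1) {z : ℂ} (hz : z ∈ sector α)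
    {x : ℝ} (hx : 1 ≤ x) (y : ℝ) :
    0 ≤ (z * ((x : ℂ) + y * Complex.I) ^ (-((1 - α : ℝ) : ℂ))).re := by
  have hπ := Real.pi_pos
  rw [mem_sector_iff hα0 hα1] at hz
  set s := (x : ℂ) + y * Complex.I with hs
  have hs0 : s ≠ 0 := add_mul_I_ne_zero hx y
  have hre : 0 < s.re := by rw [hs]; simp; linarith
  have harg := (Complex.abs_arg_lt_pi_div_two_iff).2 (Or.inl hre)
  set ψ := -(1 - α) * s.arg with hψ
  have hψa : |ψ| ≤ Real.pi / 2 - α * Real.pi / 2 := by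
    rw [hψ, abs_mul, abs_neg, abs_of_nonneg (by linarith : 0 ≤ 1 - α)]
    nlinarith [abs_nonneg s.arg]
  have hw : s ^ (-((1 - α : ℝ) : ℂ)) =
      ((‖s‖ ^ (-(1 - α)) : ℝ) : ℂ) * Complex.exp ((ψ : ℝ) * Complex.I) := by
    rw [Complex.cpow_def_of_ne_zero hs0, Complex.log,
      Real.rpow_def_of_pos (norm_pos_iff.2 hs0), hψ]
    push_cast
    rw [← Complex.exp_add]
    congr 1
    ring
  have hcos : Real.sin (α * Real.pi / 2) ≤ Real.cos ψ := by
    rw [← Real.cos_abs, ← Real.cos_pi_div_two_sub]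
    exact Real.cos_le_cos_of_nonneg_of_le_pi (abs_nonneg _) (by nlinarith) hψa
  have hsin : |Real.sin ψ| ≤ Real.cos (α * Real.pi / 2) := by
    rw [Real.abs_sin_eq_sin_abs_of_abs_le_pi (by nlinarith), ← Real.sin_pi_div_two_sub]
    exact Real.sin_le_sin_of_le_of_le_pi_div_two (by linarith [abs_nonneg ψ]) (by nlinarith) hψa
  rw [hw, mul_left_comm, Complex.re_ofReal_mul]
  refine mul_nonneg (Real.rpow_nonneg (norm_nonneg _) _) ?_
  rw [Complex.mul_re, Complex.exp_ofReal_mul_I_re, Complex.exp_ofReal_mul_I_im]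
  have hzre : 0 < z.re := by
    have h1 := mul_nonneg (abs_nonneg z.im) (cos_half_opening_nonneg hα0 hα1)
    exact pos_of_mul_pos_left (h1.trans_lt hz) (sin_half_opening_pos hα0 hα1).le
  have h1 : z.im * Real.sin ψ ≤ |z.im| * Real.cos (α * Real.pi / 2) := by
    refine (le_abs_self _).trans ?_
    rw [abs_mul]
    gcongr
  have h2 := mul_le_mul_of_nonneg_left hcos hzre.le
  linarith

/-- Integrating over the line of abscissa x gives x^(-(1-α)j) e^x, and x = j is the choice that
produces j^((α-1)j). For j = 0 the line x = 1 gives e < 3. -/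
theorem norm_wright_le {α : ℝ} (hα0 : 0 < α) (hα1 : α ≤ 1) {z : ℂ} (hz : z ∈ sector α) (j : ℕ) :
    ‖wright (1 - α) j z‖ ≤ 3 * (Real.exp 1 ^ j * gevreyBar (α - 1) j) := by
  have hπ := Real.pi_pos
  have hρ : 0 ≤ 1 - α := by linarith
  have key : ∀ x : ℝ, 1 ≤ x →
      ‖wright (1 - α) j z‖ ≤ (x ^ (-(1 - α))) ^ j * Real.exp x := by
    intro x hx
    rw [wright_eq hρ hx, norm_mul]
    have h1 : ‖∫ y : ℝ, wrightKernel (1 - α) j x z y‖ ≤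
        ∫ y : ℝ, (x ^ (-(1 - α))) ^ j * Real.exp x * (1 + y ^ 2)⁻¹ := by
      refine norm_integral_le_of_norm_le (integrable_inv_one_add_sq.const_mul _)
        (Eventually.of_forall fun y => (norm_wrightKernel_le hρ hx j z y).trans ?_)
      rw [mul_assoc]
      have := re_mul_cpow_nonneg hα0 hα1 hz hx y
      gcongr
      linarith
    rw [integral_const_mul, integral_univ_inv_one_add_sq] at h1
    have h2 : ‖(2 * Real.pi : ℂ)⁻¹‖ = (2 * Real.pi)⁻¹ := by
      rw [norm_inv, norm_mul, Complex.norm_real, Real.norm_of_nonneg hπ.le, Complex.norm_ofNat]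
    rw [h2]
    have h3 : 0 ≤ (x ^ (-(1 - α))) ^ j * Real.exp x := by positivity
    calc _ ≤ (2 * Real.pi)⁻¹ * ((x ^ (-(1 - α))) ^ j * Real.exp x * Real.pi) := by gcongr
      _ = (x ^ (-(1 - α))) ^ j * Real.exp x / 2 := by field_simp
      _ ≤ _ := half_le_self h3
  rcases Nat.eq_zero_or_pos j with rfl | hj
  · have := key 1 le_rfl
    simp only [pow_zero, one_mul, gevreyBar_zero, mul_one] at this ⊢
    exact this.trans Real.exp_one_lt_three.le
  · have hj1 : (1 : ℝ) ≤ j := by exact_mod_cast hj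
    have h1 := key j hj1
    have h2 : ((j : ℝ) ^ (-(1 - α))) ^ j = gevreyBar (α - 1) j := by
      rw [gevreyBar, ← Real.rpow_natCast, ← Real.rpow_mul (by positivity)]
      congr 1; ring
    have h3 : Real.exp j = Real.exp 1 ^ j := by rw [← Real.exp_nat_mul, mul_one]
    rw [h2, h3] at h1
    have h4 : 0 ≤ Real.exp 1 ^ j * gevreyBar (α - 1) j :=
      mul_nonneg (by positivity) (gevreyBar_pos _ _).le
    linarith

/-- Log-convexity of Γ between 2 and j + 2 at the convex combination (1-α)j + 2, followed by (j+1)!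
≤ 2^j j^j. Thus the sector bound is attained at the vertex up to a geometric factor. -/
theorem gevreyBar_le_inv_Gamma {α : ℝ} (hα0 : 0 < α) (hα1 : α ≤ 1) (j : ℕ) :
    gevreyBar (α - 1) j ≤ 2 ^ j * (Real.Gamma ((1 - α) * j + 2))⁻¹ := by
  have hρ : 0 ≤ 1 - α := by linarith
  have hΓ : 0 < Real.Gamma ((1 - α) * j + 2) := Real.Gamma_pos_of_pos (by positivity)
  suffices h : Real.Gamma ((1 - α) * j + 2) ≤ 2 ^ j * gevreyBar (1 - α) j by
    rw [← div_eq_mul_inv, le_div_iff₀ hΓ]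
    calc _ ≤ gevreyBar (α - 1) j * (2 ^ j * gevreyBar (1 - α) j) :=
          mul_le_mul_of_nonneg_left h (gevreyBar_pos _ _).le
      _ = 2 ^ j * (gevreyBar (α - 1) j * gevreyBar (1 - α) j) := by ring
      _ = 2 ^ j := by rw [gevreyBar_mul_cancel, mul_one]
  rcases hρ.eq_or_lt with h0 | hρ0
  · rw [← h0, zero_mul, zero_add, Real.Gamma_two, gevreyBar_eq_exp, zero_mul, Real.exp_zero, mul_one]
    exact one_le_pow₀ (by norm_num)
  rcases Nat.eq_zero_or_pos j with rfl | hj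
  · simp [gevreyBar_zero]
  have hj0 : (0 : ℝ) < j := by exact_mod_cast hj
  have h1 := Real.Gamma_mul_add_mul_le_rpow_Gamma_mul_rpow_Gamma (s := 2) (t := (j : ℝ) + 2)
    (a := α) (b := 1 - α) (by norm_num) (by positivity) hα0 hρ0 (by ring)
  have h2 : α * 2 + (1 - α) * ((j : ℝ) + 2) = (1 - α) * j + 2 := by ring
  have h3 : Real.Gamma ((j : ℝ) + 2) = ((j + 1).factorial : ℝ) := by
    rw [← Real.Gamma_nat_eq_factorial]; push_cast; ring_nf
  rw [h2, Real.Gamma_two, Real.one_rpow, one_mul, h3] at h1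
  have h4 : ((j + 1).factorial : ℝ) ≤ 2 ^ j * (j : ℝ) ^ j := by
    have h5 : ((j + 1).factorial : ℝ) = (j + 1) * (j.factorial : ℝ) := by
      rw [Nat.factorial_succ]; push_cast; ring
    rw [h5]
    have h6 : (j.factorial : ℝ) ≤ (j : ℝ) ^ j := by exact_mod_cast Nat.factorial_le_pow j
    have h7 : (j : ℝ) + 1 ≤ 2 ^ j := by exact_mod_cast Nat.lt_two_pow_self (n := j)
    gcongr
  calc _ ≤ ((j + 1).factorial : ℝ) ^ (1 - α) := h1
    _ ≤ (2 ^ j * (j : ℝ) ^ j) ^ (1 - α) := by gcongr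
    _ = (2 ^ j : ℝ) ^ (1 - α) * gevreyBar (1 - α) j := by
      rw [Real.mul_rpow (by positivity) (by positivity), gevreyBar, ← Real.rpow_natCast (j : ℝ) j,
        ← Real.rpow_mul hj0.le, mul_comm (j : ℝ)]
    _ ≤ (2 ^ j : ℝ) ^ (1 : ℝ) * gevreyBar (1 - α) j := by
      have := (gevreyBar_pos (1 - α) j).le
      gcongr
      · exact one_le_pow₀ (by norm_num)
      · linarith
    _ = _ := by rw [Real.rpow_one]

/-! ### Extremal functions in the class of the regularized matrix -/

/-- The geometric sequence through the indices k and k + 1 is a tangent of log L, hence lies below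
L: successive quotients increase. -/
theorem LogConvex.mul_quotient_pow_le {L : ℕ → ℝ} (hpos : ∀ i, 0 < L i) (hL : LogConvex L)
    (k j : ℕ) : L k * (L (k + 1) / L k) ^ j ≤ L j * (L (k + 1) / L k) ^ k := by
  set ν : ℕ → ℝ := fun i => L (i + 1) / L i with hν
  have hν0 : ∀ i, 0 < ν i := fun i => div_pos (hpos _) (hpos _)
  have hstep : ∀ i, ν i * L i = L (i + 1) := fun i => div_mul_cancel₀ _ (hpos i).ne'
  have hmono : Monotone ν := by
    refine monotone_nat_of_le_succ fun i => ?_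
    rw [hν]
    simp only
    rw [div_le_div_iff₀ (hpos _) (hpos _)]
    have := hL i
    linarith
  change L k * ν k ^ j ≤ L j * ν k ^ k
  rcases le_total k j with hkj | hjk
  · obtain ⟨m, rfl⟩ := Nat.exists_eq_add_of_le hkj
    have hm : L k * ν k ^ m ≤ L (k + m) := by
      induction m with
      | zero => simp
      | succ m ih =>
        have h1 := ih (by omega)
        have h2 := hmono (by omega : k ≤ k + m)
        have := (mul_pos (hpos k) (pow_pos (hν0 k) m)).le
        have := (hν0 (k + m)).le
        calc L k * ν k ^ (m + 1) = ν k * (L k * ν k ^ m) := by ring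
          _ ≤ ν (k + m) * L (k + m) := by gcongr
          _ = _ := hstep _
    calc _ = L k * ν k ^ m * ν k ^ k := by ring
      _ ≤ _ := mul_le_mul_of_nonneg_right hm (pow_pos (hν0 k) k).le
  · obtain ⟨m, rfl⟩ := Nat.exists_eq_add_of_le hjk
    have hm : L (j + m) ≤ L j * ν (j + m) ^ m := by
      clear hjk
      induction m with
      | zero => simp
      | succ m ih =>
        have h2 := hmono (by omega : j + m ≤ j + (m + 1))
        have h3 := (hpos j).le
        have h4 := (hν0 (j + m)).le
        calc L (j + (m + 1)) = ν (j + m) * L (j + m) := (hstep _).symm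
          _ ≤ ν (j + m) * (L j * ν (j + m) ^ m) := by gcongr
          _ = L j * ν (j + m) ^ (m + 1) := by ring
          _ ≤ _ := by gcongr
    calc _ ≤ L j * ν (j + m) ^ m * ν (j + m) ^ j :=
          mul_le_mul_of_nonneg_right hm (pow_pos (hν0 _) j).le
      _ = _ := by ring

theorem convex_sector {α : ℝ} (hα0 : 0 < α) (hα1 : α ≤ 1) : Convex ℝ (sector α) := by
  intro z hz w hw a b ha hb hab
  rw [mem_sector_iff hα0 hα1] at *
  have hc := cos_half_opening_nonneg hα0 hα1
  have h1 := mul_le_mul_of_nonneg_right (abs_add_le (a * z.im) (b * w.im)) hc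
  rw [abs_mul, abs_mul, abs_of_nonneg ha, abs_of_nonneg hb] at h1
  simp only [Complex.add_im, Complex.add_re, Complex.real_smul, Complex.re_ofReal_mul,
    Complex.im_ofReal_mul]
  rcases ha.eq_or_lt with rfl | ha
  · have : b = 1 := by linarith
    subst this
    linarith
  · have h2 := mul_lt_mul_of_pos_left hz ha
    have h3 := mul_le_mul_of_nonneg_left hw.le hb
    linarith

theorem ofReal_mul_mem_sector {α : ℝ} (hα0 : 0 < α) (hα1 : α ≤ 1) {t : ℝ} (ht : 0 < t) {z : ℂ}
    (hz : z ∈ sector α) : (t : ℂ) * z ∈ sector α := by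
  rw [mem_sector_iff hα0 hα1] at *
  have := mul_lt_mul_of_pos_left hz ht
  simp only [Complex.re_ofReal_mul, Complex.im_ofReal_mul, abs_mul, abs_of_pos ht]
  linarith

theorem iteratedDeriv_eq_of_hasDerivAt {D : ℕ → ℂ → ℂ} {S : Set ℂ} (hS : IsOpen S)
    (hD : ∀ j, ∀ z ∈ S, HasDerivAt (D j) (D (j + 1) z) z) (j : ℕ) :
    ∀ z ∈ S, iteratedDeriv j (D 0) z = D j z := by
  induction j with
  | zero => intro z _; rw [iteratedDeriv_zero]
  | succ j ih =>
    intro z hz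
    rw [iteratedDeriv_succ]
    have : iteratedDeriv j (D 0) =ᶠ[𝓝 z] D j := by
      filter_upwards [hS.mem_nhds hz] with w hw using ih w hw
    rw [this.deriv_eq, (hD j z hz).deriv]

/-- Superpose dilates of the Wright function, one for each tangent of the log-convex minorant. At
the vertex all terms of the j-th derivative have the sign (-1)^j, so nothing cancels, and the term k
= j alone gives the lower bound. -/
theorem IsRegularizable.exists_extremal {M : SeqFamily} {α : ℝ} (h : IsRegularizable M α)
    (p : Set.Ioi (0 : ℝ)) :
    ∃ f : ℂ → ℂ, DifferentiableOn ℂ f (sector α) ∧ DerivBound (regularized M α p) (sector α) f ∧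
      ∃ s : ℕ → ℝ, (∀ j, (1 / 4) ^ j * regularized M α p j ≤ s j) ∧
        ∀ j, Tendsto (fun x : ℝ => iteratedDeriv j f x) (𝓝[>] 0) (𝓝 ((-1) ^ j * (s j : ℂ))) := by
  have hρ : 0 ≤ 1 - α := by linarith [h.le_one]
  have hS := isOpen_sector h.pos h.le_one
  set N := lcMinorant (twisted M α p) with hN
  have hpos : ∀ i, 0 < N i := h.lc_pos p
  set ν : ℕ → ℝ := fun k => N (k + 1) / N k with hν
  have hν0 : ∀ i, 0 < ν i := fun i => div_pos (hpos _) (hpos _)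
  -- Then w_k ν_k^j is 2^(-k) times the value at j of the tangent at k, with equality to 2^(-k) N_k
  -- when j = k.
  set w : ℕ → ℝ := fun k => (1 / 2) ^ k * (N k / ν k ^ k) with hw
  have hw0 : ∀ k, 0 < w k := fun k =>
    mul_pos (by positivity) (div_pos (hpos k) (pow_pos (hν0 k) k))
  have hwν : ∀ k j, w k * ν k ^ j ≤ (1 / 2) ^ k * N j := by
    intro k j
    have h1 := LogConvex.mul_quotient_pow_le hpos (h.lc_logConvex p) k j
    rw [hw]
    simp only
    rw [mul_assoc, div_mul_eq_mul_div]
    have h2 : N k * ν k ^ j / ν k ^ k ≤ N j := (div_le_iff₀ (pow_pos (hν0 k) k)).2 h1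
    gcongr
  set T : ℕ → ℕ → ℂ → ℂ := fun j k z => ((w k * ν k ^ j : ℝ) : ℂ) * wright (1 - α) j (ν k * z)
    with hT
  set D : ℕ → ℂ → ℂ := fun j z => ∑' k, T j k z with hDdef
  set u : ℕ → ℕ → ℝ := fun j k => (1 / 2) ^ k * (3 * (Real.exp 1 ^ j * regularized M α p j)) with hu
  have hbound : ∀ j k, ∀ z ∈ sector α, ‖T j k z‖ ≤ u j k := by
    intro j k z hz
    rw [hT]
    simp only
    have h0 : 0 ≤ w k * ν k ^ j := (mul_pos (hw0 k) (pow_pos (hν0 k) j)).le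
    rw [norm_mul, Complex.norm_real, Real.norm_of_nonneg h0]
    have h1 := norm_wright_le h.pos h.le_one
      (ofReal_mul_mem_sector h.pos h.le_one (hν0 k) hz) j
    calc _ ≤ (1 / 2) ^ k * N j * (3 * (Real.exp 1 ^ j * gevreyBar (α - 1) j)) :=
          mul_le_mul (hwν k j) h1 (norm_nonneg _) (mul_nonneg (by positivity) (hpos j).le)
      _ = _ := by simp only [hu, regularized_eq, ← hN]; ring
  have hus : ∀ j, Summable (u j) := fun j =>
    (summable_geometric_of_lt_one (by norm_num) (by norm_num)).mul_right _
  have hderT : ∀ j k z, HasDerivAt (T j k) (T (j + 1) k z) z := by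
    intro j k z
    have h1 : HasDerivAt (fun z : ℂ => (ν k : ℂ) * z) (ν k : ℂ) z := by
      simpa using (hasDerivAt_id z).const_mul (ν k : ℂ)
    have h2 := ((hasDerivAt_wright hρ j ((ν k : ℂ) * z)).comp z h1).const_mul
      ((w k * ν k ^ j : ℝ) : ℂ)
    refine h2.congr_deriv ?_
    rw [hT]
    push_cast
    ring
  have h1S : (1 : ℂ) ∈ sector α := by simpa using ofReal_mem_sector h.pos one_pos
  have hD : ∀ j, ∀ z ∈ sector α, HasDerivAt (D j) (D (j + 1) z) z := by
    intro j z hz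
    exact hasDerivAt_tsum_of_isPreconnected (hus (j + 1)) hS
      (convex_sector h.pos h.le_one).isPreconnected (fun k y _ => hderT j k y)
      (fun k y hy => hbound (j + 1) k y hy) h1S
      (Summable.of_norm_bounded (hus j) fun k => hbound j k 1 h1S) hz
  have hiter := iteratedDeriv_eq_of_hasDerivAt hS hD
  have hΓ : ∀ j : ℕ, 0 < (Real.Gamma ((1 - α) * j + 2))⁻¹ := fun j =>
    inv_pos.2 (Real.Gamma_pos_of_pos (by positivity))
  have hsum : ∀ j, Summable fun k => w k * ν k ^ j := fun j =>
    Summable.of_nonneg_of_le (fun k => (mul_pos (hw0 k) (pow_pos (hν0 k) j)).le)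
      (fun k => hwν k j) ((summable_geometric_of_lt_one (by norm_num) (by norm_num)).mul_right _)
  refine ⟨D 0, fun z hz => (hD 0 z hz).differentiableAt.differentiableWithinAt,
    ⟨Real.exp 1, Real.exp_pos 1, ∑' k : ℕ, (1 / 2) ^ k * 3, fun z hz j => ?_⟩,
    fun j => (∑' k, w k * ν k ^ j) * (Real.Gamma ((1 - α) * j + 2))⁻¹, fun j => ?_, fun j => ?_⟩
  · rw [hiter j z hz]
    refine (tsum_of_norm_bounded (hus j).hasSum fun k => hbound j k z hz).trans_eq ?_
    rw [← tsum_mul_right]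
    refine tsum_congr fun k => ?_
    rw [hu]; ring
  -- In the factor 4^(-j), one 2^(-j) is the weight of the term k = j and the other pays for the
  -- Gamma comparison.
  · have h1 := (hsum j).le_tsum j fun k _ => (mul_pos (hw0 k) (pow_pos (hν0 k) j)).le
    have h2 : w j * ν j ^ j = (1 / 2) ^ j * N j := by
      have := (pow_pos (hν0 j) j).ne'
      rw [hw]; field_simp
    have h3 := gevreyBar_le_inv_Gamma h.pos h.le_one j
    rw [h2] at h1
    calc (1 / 4) ^ j * regularized M α p j
        = (1 / 4) ^ j * N j * gevreyBar (α - 1) j := by rw [regularized_eq]; ring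
      _ ≤ (1 / 4) ^ j * N j * (2 ^ j * (Real.Gamma ((1 - α) * j + 2))⁻¹) :=
          mul_le_mul_of_nonneg_left h3 (mul_nonneg (by positivity) (hpos j).le)
      _ = (1 / 2) ^ j * N j * (Real.Gamma ((1 - α) * j + 2))⁻¹ := by
          have : (1 / 4 : ℝ) ^ j * 2 ^ j = (1 / 2) ^ j := by rw [← mul_pow]; norm_num
          rw [← this]; ring
      _ ≤ _ := mul_le_mul_of_nonneg_right h1 (hΓ j).le
  · have hlim : (-1) ^ j * (((∑' k, w k * ν k ^ j) * (Real.Gamma ((1 - α) * j + 2))⁻¹ : ℝ) : ℂ) =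
        ∑' k, T j k 0 := by
      rw [hT]
      simp only [mul_zero, wright_zero hρ]
      rw [tsum_mul_right]
      push_cast
      ring
    rw [hlim]
    have hev : ∀ᶠ x : ℝ in 𝓝[>] 0, D j x = iteratedDeriv j (D 0) x := by
      filter_upwards [self_mem_nhdsWithin] with x hx
      exact (hiter j x (ofReal_mem_sector h.pos hx)).symm
    refine Tendsto.congr' hev ?_
    refine tendsto_tsum_of_dominated_convergence (hus j) (fun k => ?_) ?_
    · have h1 : Tendsto (fun x : ℝ => (x : ℂ)) (𝓝[>] 0) (𝓝 0) :=
        (Complex.continuous_ofReal.tendsto' 0 0 (by simp)).mono_left nhdsWithin_le_nhds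
      exact (hderT j k 0).continuousAt.tendsto.comp h1
    · filter_upwards [self_mem_nhdsWithin] with x hx k
      exact hbound j k x (ofReal_mem_sector h.pos hx)

/-! ### Inverse-closedness implies the root almost increasing property -/

/-- The Taylor coefficients of `1 / (c - ∑_{i ≥ 1} s_i X ^ i)`. -/
noncomputable def recipCoeff (c : ℝ) (s : ℕ → ℝ) : ℕ → ℝ
  | 0 => c⁻¹
  | k + 1 => c⁻¹ * ∑ i : Fin (k + 1), s (i + 1) * recipCoeff c s (k - i)
decreasing_by omega

theorem recipCoeff_zero (c : ℝ) (s : ℕ → ℝ) : recipCoeff c s 0 = c⁻¹ := by rw [recipCoeff]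

theorem recipCoeff_succ (c : ℝ) (s : ℕ → ℝ) (k : ℕ) :
    recipCoeff c s (k + 1) =
      c⁻¹ * ∑ i ∈ Finset.range (k + 1), s (i + 1) * recipCoeff c s (k - i) := by
  rw [recipCoeff, Finset.sum_range]

theorem recipCoeff_nonneg {c : ℝ} {s : ℕ → ℝ} (hc : 0 < c) (hs : ∀ i, 0 ≤ s i) (k : ℕ) :
    0 ≤ recipCoeff c s k := by
  induction k using Nat.strong_induction_on with
  | _ k ih =>
    rcases k with _ | k
    · rw [recipCoeff_zero]; positivity
    · rw [recipCoeff_succ]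
      exact mul_nonneg (inv_pos.2 hc).le
        (Finset.sum_nonneg fun i _ => mul_nonneg (hs _) (ih _ (by omega)))

/-- All terms of the recursion are nonnegative; keep only the one with s_j, l times in succession.
-/
theorem le_recipCoeff_mul {c : ℝ} {s : ℕ → ℝ} (hc : 0 < c) (hs : ∀ i, 0 ≤ s i) {j : ℕ}
    (hj : 1 ≤ j) (l : ℕ) : c⁻¹ * (c⁻¹ * s j) ^ l ≤ recipCoeff c s (l * j) := by
  induction l with
  | zero => simp [recipCoeff_zero]
  | succ l ih =>
    obtain ⟨i, rfl⟩ := Nat.exists_eq_add_of_le' hj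
    have e : (l + 1) * (i + 1) = (l * (i + 1) + i) + 1 := by ring
    rw [e, recipCoeff_succ]
    have h1 := Finset.single_le_sum (f := fun m => s (m + 1) *
        recipCoeff c s (l * (i + 1) + i - m)) (s := Finset.range (l * (i + 1) + i + 1))
      (fun m _ => mul_nonneg (hs _) (recipCoeff_nonneg hc hs _))
      (Finset.mem_range.2 (by omega : i < l * (i + 1) + i + 1))
    simp only [Nat.add_sub_cancel] at h1
    have hc' := (inv_pos.2 hc).le
    calc _ = c⁻¹ * (s (i + 1) * (c⁻¹ * (c⁻¹ * s (i + 1)) ^ l)) := by ring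
      _ ≤ c⁻¹ * (s (i + 1) * recipCoeff c s (l * (i + 1))) := by
        have := hs (i + 1)
        gcongr
      _ ≤ _ := by gcongr

/-- Leibniz' rule for u · (1/u) = 1 expresses each derivative of 1/u through earlier ones; the
recursion passes to the limit at the boundary point 0. The signs disappear because they amount to
expanding in -z. -/
theorem tendsto_iteratedDeriv_inv {S : Set ℂ} (hS : IsOpen S)
    (hpos : ∀ x : ℝ, 0 < x → (x : ℂ) ∈ S) {u : ℂ → ℂ} (hu : DifferentiableOn ℂ u S)
    (hu0 : ∀ z ∈ S, u z ≠ 0) {c : ℝ} (hc : 0 < c) {s : ℕ → ℝ}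
    (h0 : Tendsto (fun x : ℝ => u x) (𝓝[>] 0) (𝓝 (c : ℂ)))
    (hs : ∀ j, 1 ≤ j → Tendsto (fun x : ℝ => iteratedDeriv j u x) (𝓝[>] 0)
      (𝓝 (-((-1) ^ j * (s j : ℂ))))) (k : ℕ) :
    Tendsto (fun x : ℝ => iteratedDeriv k (fun z => 1 / u z) x) (𝓝[>] 0)
      (𝓝 ((-1) ^ k * (k.factorial : ℂ) *
        (recipCoeff c (fun j => s j / (j.factorial : ℝ)) k : ℂ))) := by
  have hcC : (c : ℂ) ≠ 0 := by exact_mod_cast hc.ne'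
  set γ := recipCoeff c (fun j => s j / (j.factorial : ℝ)) with hγ
  have hg : DifferentiableOn ℂ (fun z => 1 / u z) S := fun z hz =>
    (differentiableWithinAt_const _).fun_div (hu z hz) (hu0 z hz)
  induction k using Nat.strong_induction_on with
  | _ k ih =>
    rcases k with _ | k
    · simp only [iteratedDeriv_zero, pow_zero, Nat.factorial_zero, Nat.cast_one, one_mul, hγ,
        recipCoeff_zero, one_div]
      push_cast
      exact h0.inv₀ hcC
    · have hleib : ∀ x : ℝ, 0 < x → iteratedDeriv (k + 1) (fun z => 1 / u z) x =
          (u x)⁻¹ * ∑ i ∈ Finset.range (k + 1), -(((k + 1).choose (i + 1) : ℕ) *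
            iteratedDeriv (i + 1) u x * iteratedDeriv (k - i) (fun z => 1 / u z) x) := by
        intro x hx
        have hxS := hpos x hx
        have hux : ContDiffAt ℂ ((k + 1 : ℕ) : WithTop ℕ∞) u x :=
          (hu.analyticAt (hS.mem_nhds hxS)).contDiffAt
        have hgx : ContDiffAt ℂ ((k + 1 : ℕ) : WithTop ℕ∞) (fun z => 1 / u z) x :=
          (hg.analyticAt (hS.mem_nhds hxS)).contDiffAt
        have h1 := iteratedDeriv_mul hux hgx
        have h2 : u * (fun z => 1 / u z) =ᶠ[𝓝 (x : ℂ)] fun _ => 1 := by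
          filter_upwards [hS.mem_nhds hxS] with z hz
          simp [hu0 z hz]
        rw [h2.iteratedDeriv_eq, iteratedDeriv_const, if_neg (by omega),
          Finset.sum_range_succ'] at h1
        simp only [Nat.choose_zero_right, Nat.cast_one, one_mul, iteratedDeriv_zero,
          Nat.add_sub_add_right, Nat.sub_zero] at h1
        rw [eq_inv_mul_iff_mul_eq₀ (hu0 x hxS), Finset.sum_neg_distrib]
        linear_combination -h1
      have hev : ∀ᶠ x : ℝ in 𝓝[>] 0, (u x)⁻¹ * ∑ i ∈ Finset.range (k + 1),
          -(((k + 1).choose (i + 1) : ℕ) * iteratedDeriv (i + 1) u x *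
            iteratedDeriv (k - i) (fun z => 1 / u z) x) =
          iteratedDeriv (k + 1) (fun z => 1 / u z) x := by
        filter_upwards [self_mem_nhdsWithin] with x hx using (hleib x hx).symm
      refine Tendsto.congr' hev ?_
      have hval : (-1 : ℂ) ^ (k + 1) * ((k + 1).factorial : ℂ) * (γ (k + 1) : ℂ) =
          (c : ℂ)⁻¹ * ∑ i ∈ Finset.range (k + 1), -((((k + 1).choose (i + 1) : ℕ) : ℂ) *
            (-((-1) ^ (i + 1) * (s (i + 1) : ℂ))) *
            ((-1) ^ (k - i) * ((k - i).factorial : ℂ) * (γ (k - i) : ℂ))) := by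
        rw [hγ, recipCoeff_succ]
        push_cast
        rw [mul_left_comm, Finset.mul_sum]
        congr 1
        refine Finset.sum_congr rfl fun i hi => ?_
        have hik : i ≤ k := by have := Finset.mem_range.1 hi; omega
        have h1 := Nat.choose_mul_factorial_mul_factorial (by omega : i + 1 ≤ k + 1)
        rw [Nat.add_sub_add_right] at h1
        have h2 : (((k + 1).factorial : ℕ) : ℂ) = ((k + 1).choose (i + 1) : ℂ) *
            ((i + 1).factorial : ℂ) * ((k - i).factorial : ℂ) := by exact_mod_cast h1.symm
        have h3 : (-1 : ℂ) ^ (k + 1) = (-1) ^ (i + 1) * (-1) ^ (k - i) := by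
          rw [← pow_add]; congr 1; omega
        have h4 : ((i + 1).factorial : ℂ) ≠ 0 := by exact_mod_cast (i + 1).factorial_ne_zero
        rw [h2, h3]
        field_simp
      rw [hval]
      refine (h0.inv₀ hcC).mul (tendsto_finsetSum _ fun i hi => ?_)
      exact ((tendsto_const_nhds.mul (hs (i + 1) (by omega))).mul (ih (k - i) (by omega))).neg

theorem IsRegularizable.rai_of_inverseClosed {M : SeqFamily} {α : ℝ} (h : IsRegularizable M α)
    (hinv : InverseClosed M (sector α)) : Rai (regularized M α) := by
  refine h.rai_of_multiples fun p => ?_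
  obtain ⟨f, hf, ⟨H, hH, K, hK⟩, s, hs, hlim⟩ := h.exists_extremal p
  have hS := isOpen_sector h.pos h.le_one
  have hspos : ∀ j, 0 < s j := fun j =>
    lt_of_lt_of_le (mul_pos (by positivity) (h.regularized_pos p j)) (hs j)
  have h1S : (1 : ℂ) ∈ sector α := by simpa using ofReal_mem_sector h.pos one_pos
  have hK0 : ∀ z ∈ sector α, ‖f z‖ ≤ K := by
    intro z hz
    simpa [h.regularized_zero] using hK z hz 0
  have hKnn : 0 ≤ K := (norm_nonneg _).trans (hK0 1 h1S)
  -- With |f| ≤ K this gives |c + s_0 - f| ≥ 1 on the sector, while the limit at the vertex is c.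
  set c : ℝ := K + 1 with hc
  have hc1 : 1 ≤ c := by linarith
  have hc0 : 0 < c := by linarith
  set u : ℂ → ℂ := fun z => ((c + s 0 : ℝ) : ℂ) - f z with hu
  have hud : DifferentiableOn ℂ u (sector α) := hf.const_sub _
  have hulow : ∀ z ∈ sector α, 1 ≤ ‖u z‖ := by
    intro z hz
    have h1 := norm_sub_norm_le ((c + s 0 : ℝ) : ℂ) (f z)
    rw [Complex.norm_real, Real.norm_of_nonneg (by linarith [hspos 0])] at h1
    linarith [hK0 z hz, hspos 0]
  have huj : ∀ j, 1 ≤ j → ∀ z, iteratedDeriv j u z = -iteratedDeriv j f z := by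
    intro j hj z
    rw [hu, iteratedDeriv_const_sub hj, iteratedDeriv_neg]
  have humem : u ∈ ultraClass M (sector α) := by
    refine ⟨hud, p, H, hH, K + (c + s 0), fun z hz j => ?_⟩
    have hle := h.regularized_le p j
    have hpos : 0 < H ^ j * M p j := mul_pos (pow_pos hH j) (h.weight.pos p j)
    have hKM : K * (H ^ j * regularized M α p j) ≤ K * (H ^ j * M p j) := by gcongr
    rcases Nat.eq_zero_or_pos j with rfl | hj
    · simp only [iteratedDeriv_zero, pow_zero, h.weight.zero, mul_one]
      have h1 := norm_sub_le ((c + s 0 : ℝ) : ℂ) (f z)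
      rw [Complex.norm_real, Real.norm_of_nonneg (by linarith [hspos 0])] at h1
      linarith [hK0 z hz]
    · rw [huj j hj, norm_neg]
      refine ((hK z hz j).trans hKM).trans ?_
      exact mul_le_mul_of_nonneg_right (by linarith [hspos 0]) hpos.le
  obtain ⟨hgd, q, hgq⟩ := hinv u humem ⟨1, one_pos, hulow⟩
  -- Inverse-closedness only gives the estimates of `M`; the root property concerns the regularized
  -- matrix.
  obtain ⟨H', hH', C', hC'⟩ := derivBound_regularized h hgd hgq
  have hlim0 := hlim 0
  simp only [iteratedDeriv_zero, pow_zero, one_mul] at hlim0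
  have hu0 : Tendsto (fun x : ℝ => u x) (𝓝[>] 0) (𝓝 (c : ℂ)) := by
    have := (tendsto_const_nhds (x := ((c + s 0 : ℝ) : ℂ))).sub hlim0
    refine this.trans (le_of_eq ?_)
    congr 1
    push_cast
    ring
  have hγ := tendsto_iteratedDeriv_inv hS (fun x hx => ofReal_mem_sector h.pos hx) hud
    (fun z hz => norm_pos_iff.1 (one_pos.trans_le (hulow z hz))) hc0 hu0
    (s := s) (fun j hj => by
      simp only [huj j hj]
      exact (hlim j).neg)
  set σ : ℕ → ℝ := fun j => s j / (j.factorial : ℝ) with hσ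
  have hσ0 : ∀ i, 0 ≤ σ i := fun i => (div_pos (hspos i) (by exact_mod_cast i.factorial_pos)).le
  have hγle : ∀ k, recipCoeff c σ k ≤ C' * (H' ^ k * check (regularized M α q) k) := by
    intro k
    have hkf : (0 : ℝ) < k.factorial := by exact_mod_cast k.factorial_pos
    have h1 := le_of_tendsto (hγ k).norm (b := C' * (H' ^ k * regularized M α q k)) (by
      filter_upwards [self_mem_nhdsWithin] with x hx
      exact hC' x (ofReal_mem_sector h.pos hx) k)
    rw [norm_mul, norm_mul, norm_pow, norm_neg, norm_one, one_pow, one_mul, Complex.norm_natCast,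
      Complex.norm_real, Real.norm_of_nonneg (recipCoeff_nonneg hc0 hσ0 k)] at h1
    have h2 : C' * (H' ^ k * check (regularized M α q) k) =
        C' * (H' ^ k * regularized M α q k) / k.factorial := by rw [check]; ring
    rw [h2, le_div_iff₀ hkf]
    linarith
  set C := max C' 1 with hC
  have hC1 : 1 ≤ C := le_max_right _ _
  -- Since c and C are at least 1, the factors c^(l+1) and C are absorbed into powers of exponent
  -- lj; the 4 comes from the extremal function.
  refine ⟨c ^ 2 * C * (4 * H'), by positivity, q, fun j l hj hl => ?_⟩
  have h1 := (le_recipCoeff_mul hc0 hσ0 hj l).trans (hγle (l * j))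
  have hchk := h.check_pos q (l * j)
  have h2 : (1 / 4) ^ j * check (regularized M α p) j ≤ σ j := by
    have h3 := hs j
    rw [check, ← mul_div_assoc]
    exact div_le_div_of_nonneg_right h3 (by positivity)
  have hp := (h.check_pos p j).le
  have h4 : c⁻¹ * (c⁻¹ * ((1 / 4) ^ j * check (regularized M α p) j)) ^ l ≤
      C * (H' ^ (l * j) * check (regularized M α q) (l * j)) := by
    refine le_trans ?_ (h1.trans ?_)
    · gcongr
    · gcongr
      exact le_max_left _ _
  have hlj : 1 ≤ l * j := Nat.mul_pos hl hj
  have hljl : l ≤ l * j := Nat.le_mul_of_pos_right l hj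
  have e : check (regularized M α p) j ^ l = c ^ (l + 1) * 4 ^ (l * j) *
      (c⁻¹ * (c⁻¹ * ((1 / 4) ^ j * check (regularized M α p) j)) ^ l) := by
    have h5 : ((1 / 4 : ℝ) ^ j) ^ l * 4 ^ (l * j) = 1 := by
      rw [← pow_mul, mul_comm j l, ← mul_pow]; norm_num
    have h6 : c ^ (l + 1) * (c⁻¹ * (c⁻¹) ^ l) = 1 := by
      rw [pow_succ, inv_pow]
      field_simp
    rw [mul_pow, mul_pow]
    calc _ = 1 * 1 * check (regularized M α p) j ^ l := by ring
      _ = (c ^ (l + 1) * (c⁻¹ * (c⁻¹) ^ l)) * (((1 / 4 : ℝ) ^ j) ^ l * 4 ^ (l * j)) *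
          check (regularized M α p) j ^ l := by rw [h5, h6]
      _ = _ := by ring
  rw [e]
  calc _ ≤ c ^ (l + 1) * 4 ^ (l * j) *
        (C * (H' ^ (l * j) * check (regularized M α q) (l * j))) := by gcongr
    _ ≤ c ^ (2 * (l * j)) * 4 ^ (l * j) *
        (C ^ (l * j) * (H' ^ (l * j) * check (regularized M α q) (l * j))) := by
      gcongr
      · omega
      · exact le_self_pow₀ hC1 (by omega)
    _ = _ := by
      rw [mul_pow, mul_pow, mul_pow, pow_mul c 2]; ring

/-! ### Composition with holomorphic functions -/

/-- Faà di Bruno's formula in the form of composition of power series, where the k-th coefficient is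
a sum over compositions of k. -/
theorem norm_iteratedDeriv_comp_le {f g : ℂ → ℂ} {z : ℂ} (hf : AnalyticAt ℂ f z)
    (hg : AnalyticAt ℂ g (f z)) (k : ℕ) :
    ‖iteratedDeriv k (g ∘ f) z‖ / (k.factorial : ℝ) ≤
      ∑ c : Composition k, ‖iteratedDeriv c.length g (f z)‖ / (c.length.factorial : ℝ) *
        ∏ i : Fin c.length,
          ‖iteratedDeriv (c.blocksFun i) f z‖ / ((c.blocksFun i).factorial : ℝ) := by
  have hnorm : ∀ (φ : ℂ → ℂ) (w : ℂ) (n : ℕ),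
      ‖FormalMultilinearSeries.ofScalars ℂ (fun n => iteratedDeriv n φ w / (n.factorial : ℂ)) n‖ =
        ‖iteratedDeriv n φ w‖ / (n.factorial : ℝ) := by
    intro φ w n
    rw [FormalMultilinearSeries.ofScalars_norm, norm_div, Complex.norm_natCast]
  have heq := (hg.comp hf).hasFPowerSeriesAt.eq_formalMultilinearSeries
    (hg.hasFPowerSeriesAt.comp hf.hasFPowerSeriesAt)
  rw [← hnorm, heq]
  refine (norm_sum_le _ _).trans (Finset.sum_le_sum fun c _ => ?_)
  refine (FormalMultilinearSeries.compAlongComposition_norm _ _ c).trans_eq ?_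
  simp only [hnorm]

/-- Cauchy's estimates on discs of one radius δ whose union stays in a compact subset of U. -/
theorem exists_iteratedDeriv_bound_of_isCompact {g : ℂ → ℂ} {U K : Set ℂ} (hU : IsOpen U)
    (hg : DifferentiableOn ℂ g U) (hK : IsCompact K) (hKU : K ⊆ U) :
    ∃ C ρ : ℝ, 0 < C ∧ 0 < ρ ∧
      ∀ z ∈ K, ∀ j : ℕ, ‖iteratedDeriv j g z‖ ≤ C * (ρ ^ j * (j.factorial : ℝ)) := by
  obtain ⟨δ, hδ, hsub⟩ := hK.exists_cthickening_subset_open hU hKU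
  obtain ⟨C, hC⟩ := (hK.cthickening (r := δ)).exists_bound_of_continuousOn
    (hg.continuousOn.mono hsub)
  refine ⟨max C 1, δ⁻¹, lt_max_of_lt_right one_pos, by positivity, fun z hz j => ?_⟩
  have hball : Metric.closedBall z δ ⊆ Metric.cthickening δ K :=
    Metric.closedBall_subset_cthickening hz δ
  have hd : DiffContOnCl ℂ g (Metric.ball z δ) := by
    refine DifferentiableOn.diffContOnCl (hg.mono ?_)
    rw [closure_ball z hδ.ne']
    exact hball.trans hsub
  have h1 := Complex.norm_iteratedDeriv_le_of_forall_mem_sphere_norm_le (C := max C 1) j hδ hd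
    fun w hw => (hC w (hball (Metric.sphere_subset_closedBall hw))).trans (le_max_left _ _)
  refine h1.trans_eq ?_
  rw [inv_pow]
  ring

/-- X is the k-th root of the target. Being the same for all blocks b ≤ k, it makes a product over a
composition of k collapse to (CX)^k. -/
theorem Rai.check_le_pow {M : SeqFamily} {α : ℝ} (h : IsRegularizable M α)
    (hr : Rai (regularized M α)) (p : Set.Ioi (0 : ℝ)) :
    ∃ C : ℝ, 0 < C ∧ ∃ q, ∀ k : ℕ, ∃ X : ℝ, 0 ≤ X ∧ X ^ k = check (regularized M α q) k ∧
      ∀ b ≤ k, check (regularized M α p) b ≤ (C * X) ^ b := by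
  obtain ⟨C, hC, q, hq⟩ := hr p
  refine ⟨C, hC, q, fun k => ⟨check (regularized M α q) k ^ (1 / (k : ℝ)),
    Real.rpow_nonneg (h.check_pos q k).le _, ?_, fun b hb => ?_⟩⟩
  · rcases Nat.eq_zero_or_pos k with rfl | hk
    · rw [pow_zero, h.check_zero]
    · rw [one_div, Real.rpow_inv_natCast_pow (h.check_pos q k).le (by omega)]
  · rcases Nat.eq_zero_or_pos b with rfl | hb0
    · rw [pow_zero, h.check_zero]
    · have h1 := pow_le_pow_left₀ (Real.rpow_nonneg (h.check_pos p b).le _) (hq b k hb0 hb) b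
      rwa [one_div (b : ℝ), Real.rpow_inv_natCast_pow (h.check_pos p b).le (by omega)] at h1

theorem IsRegularizable.holomorphicallyClosed_of_rai {M : SeqFamily} {α : ℝ}
    (h : IsRegularizable M α) (hr : Rai (regularized M α)) :
    HolomorphicallyClosed M (sector α) := by
  rintro f ⟨hf, p, hb⟩ U hU hUf g hg
  have hS := isOpen_sector h.pos h.le_one
  obtain ⟨H, hH, K', hK'⟩ := derivBound_regularized h hf hb
  set K := max K' 1 with hK
  have hK1 : 1 ≤ K := le_max_right _ _
  have hfb : ∀ z ∈ sector α, ∀ j, ‖iteratedDeriv j f z‖ ≤ K * (H ^ j * regularized M α p j) :=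
    fun z hz j => (hK' z hz j).trans (mul_le_mul_of_nonneg_right (le_max_left _ _)
      (mul_pos (pow_pos hH j) (h.regularized_pos p j)).le)
  have hmem : ∀ z ∈ sector α, f z ∈ closure (f '' sector α) := fun z hz =>
    subset_closure (Set.mem_image_of_mem f hz)
  have hcomp : IsCompact (closure (f '' sector α)) := by
    refine Bornology.IsBounded.isCompact_closure ?_
    refine (Metric.isBounded_closedBall (x := (0 : ℂ)) (r := K)).subset ?_
    rintro _ ⟨z, hz, rfl⟩
    simpa [h.regularized_zero] using hfb z hz 0
  obtain ⟨C, ρ, hC, hρ, hgb⟩ := exists_iteratedDeriv_bound_of_isCompact hU hg hcomp hUf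
  obtain ⟨C₂, hC₂, q, hq⟩ := hr.check_le_pow h p
  -- The 2 counts the 2^(k-1) compositions, the maximum absorbs powers indexed by the number of
  -- blocks, and H C₂ comes from the blocks themselves.
  refine ⟨hg.comp hf fun z hz => hUf (hmem z hz), q, 2 * (max (ρ * K) 1 * (H * C₂)), by positivity,
    C, fun z hz k => ?_⟩
  obtain ⟨X, hX0, hXk, hXb⟩ := hq k
  have hkf : (0 : ℝ) < k.factorial := by exact_mod_cast k.factorial_pos
  have hmain := norm_iteratedDeriv_comp_le (hf.analyticAt (hS.mem_nhds hz))
    (hg.analyticAt (hU.mem_nhds (hUf (hmem z hz)))) k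
  have hterm : ∀ c : Composition k,
      ‖iteratedDeriv c.length g (f z)‖ / (c.length.factorial : ℝ) *
        ∏ i : Fin c.length, ‖iteratedDeriv (c.blocksFun i) f z‖ / ((c.blocksFun i).factorial : ℝ) ≤
      C * (max (ρ * K) 1 * (H * C₂)) ^ k * check (regularized M α q) k := by
    intro c
    have h1 : ‖iteratedDeriv c.length g (f z)‖ / (c.length.factorial : ℝ) ≤ C * ρ ^ c.length := by
      rw [div_le_iff₀ (by exact_mod_cast Nat.factorial_pos _)]
      exact (hgb _ (hmem z hz) _).trans_eq (by ring)
    have h2 : ∏ i : Fin c.length,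
        ‖iteratedDeriv (c.blocksFun i) f z‖ / ((c.blocksFun i).factorial : ℝ) ≤
        ∏ i : Fin c.length, K * (H * (C₂ * X)) ^ (c.blocksFun i) := by
      refine Finset.prod_le_prod (fun i _ => by positivity) fun i _ => ?_
      have h3 := hXb _ (c.blocksFun_le i)
      calc _ ≤ K * (H ^ (c.blocksFun i) * regularized M α p (c.blocksFun i)) /
            ((c.blocksFun i).factorial : ℝ) :=
            div_le_div_of_nonneg_right (hfb z hz _) (by positivity)
        _ = K * (H ^ (c.blocksFun i) * check (regularized M α p) (c.blocksFun i)) := by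
            rw [check]; ring
        _ ≤ K * (H ^ (c.blocksFun i) * (C₂ * X) ^ (c.blocksFun i)) := by gcongr
        _ = _ := by rw [mul_pow H]
    have h4 : ∏ i : Fin c.length, K * (H * (C₂ * X)) ^ (c.blocksFun i) =
        K ^ c.length * (H * (C₂ * X)) ^ k := by
      rw [Finset.prod_mul_distrib, Finset.prod_pow_eq_pow_sum, c.sum_blocksFun]
      simp
    rw [h4] at h2
    have h5 : (ρ * K) ^ c.length ≤ max (ρ * K) 1 ^ k :=
      (pow_le_pow_left₀ (by positivity) (le_max_left _ _) _).trans
        (pow_le_pow_right₀ (le_max_right _ _) c.length_le)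
    calc _ ≤ C * ρ ^ c.length * (K ^ c.length * (H * (C₂ * X)) ^ k) := by
          gcongr
      _ = C * (ρ * K) ^ c.length * (H * C₂) ^ k * X ^ k := by
          simp only [mul_pow]; ring
      _ ≤ C * max (ρ * K) 1 ^ k * (H * C₂) ^ k * X ^ k := by gcongr
      _ = _ := by rw [hXk, mul_pow (max (ρ * K) 1)]; ring
  have hsum := hmain.trans (Finset.sum_le_sum fun c _ => hterm c)
  rw [Finset.sum_const, Finset.card_univ, composition_card, nsmul_eq_mul,
    div_le_iff₀ hkf] at hsum
  have hchk := (h.check_pos q k).le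
  refine hsum.trans ?_
  have h2k : ((2 ^ (k - 1) : ℕ) : ℝ) ≤ 2 ^ k := by
    push_cast
    exact pow_le_pow_right₀ one_le_two (Nat.sub_le k 1)
  calc _ ≤ 2 ^ k * (C * (max (ρ * K) 1 * (H * C₂)) ^ k * check (regularized M α q) k) *
        (k.factorial : ℝ) := by gcongr
    _ = C * ((2 * (max (ρ * K) 1 * (H * C₂))) ^ k * regularized M α q k) := by
      rw [check, mul_pow 2]; field_simp
    _ ≤ _ := by
      have := h.regularized_le q k
      gcongr

theorem HolomorphicallyClosed.inverseClosed {M : SeqFamily} {S : Set ℂ}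
    (h : HolomorphicallyClosed M S) : InverseClosed M S := by
  rintro f hf ⟨δ, hδ, hlow⟩
  refine h f hf {0}ᶜ isOpen_compl_singleton ?_ (fun w => 1 / w) fun w hw =>
    (DifferentiableAt.fun_div (differentiableAt_const 1) differentiableAt_id
      (by simpa using hw)).differentiableWithinAt
  have h1 : closure (f '' S) ⊆ {w | δ ≤ ‖w‖} := by
    refine closure_minimal ?_ (isClosed_le continuous_const continuous_norm)
    rintro _ ⟨z, hz, rfl⟩
    exact hlow z hz
  intro w hw h0
  have h2 : δ ≤ ‖w‖ := h1 hw
  rw [Set.mem_singleton_iff.1 h0, norm_zero] at h2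
  linarith

/-! ### Consequences of containing the real analytic class -/

theorem exists_pos_le_of_eventually_one_le {a : ℕ → ℝ} (ha : ∀ j, 0 < a j)
    (h : ∀ᶠ j in atTop, 1 ≤ a j) : ∃ c : ℝ, 0 < c ∧ ∀ j, c ≤ a j := by
  obtain ⟨J, hJ⟩ := eventually_atTop.1 h
  have hfin : ∀ J : ℕ, ∃ c : ℝ, 0 < c ∧ ∀ j < J, c ≤ a j := by
    intro J
    induction J with
    | zero => exact ⟨1, one_pos, fun j hj => by omega⟩
    | succ J ih =>
      obtain ⟨c, hc, hle⟩ := ih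
      refine ⟨min c (a J), lt_min hc (ha J), fun j hj => ?_⟩
      rcases Nat.lt_succ_iff_lt_or_eq.1 hj with h | rfl
      · exact (min_le_left _ _).trans (hle j h)
      · exact min_le_right _ _
  obtain ⟨c, hc, hle⟩ := hfin J
  refine ⟨min c 1, lt_min hc one_pos, fun j => ?_⟩
  rcases lt_or_ge j J with h | h
  · exact (min_le_left _ _).trans (hle j h)
  · exact (min_le_right _ _).trans (hJ j h)

theorem COmega.exists_lower_bound {M : SeqFamily} (hM : IsWeightMatrix M) (h : COmega M) :
    ∃ p, ∃ c ε : ℝ, 0 < c ∧ 0 < ε ∧ ∀ j, c * ε ^ j * (j.factorial : ℝ) ≤ M p j := by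
  obtain ⟨p, hp⟩ := h
  -- A value strictly below the lower limit is finite even when that limit is infinite.
  obtain ⟨b, hb0, hb⟩ := exists_between hp
  have hbt : b ≠ ⊤ := (hb.trans_le le_top).ne
  have hε : 0 < b.toReal := ENNReal.toReal_pos hb0.ne' hbt
  have hck : ∀ j, 0 < check (M p) j := fun j =>
    div_pos (hM.pos p j) (by exact_mod_cast j.factorial_pos)
  have hev : ∀ᶠ j : ℕ in atTop, 1 ≤ check (M p) j / b.toReal ^ j := by
    filter_upwards [eventually_lt_of_lt_liminf hb, eventually_ge_atTop 1] with j hj hj1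
    rw [one_le_div (pow_pos hε j)]
    have h1 : b.toReal ≤ check (M p) j ^ (1 / (j : ℝ)) :=
      (ENNReal.lt_ofReal_iff_toReal_lt hbt).1 hj |>.le
    have h2 := pow_le_pow_left₀ hε.le h1 j
    rwa [one_div, Real.rpow_inv_natCast_pow (hck j).le (by omega)] at h2
  obtain ⟨c, hc, hle⟩ := exists_pos_le_of_eventually_one_le
    (fun j => div_pos (hck j) (pow_pos hε j)) hev
  refine ⟨p, c, b.toReal, hc, hε, fun j => ?_⟩
  have h1 := hle j
  rw [le_div_iff₀ (pow_pos hε j), check, le_div_iff₀ (by exact_mod_cast j.factorial_pos)] at h1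
  exact h1

theorem COmega.mem_localClass {M : SeqFamily} (hM : IsWeightMatrix M) (h : COmega M) {U : Set ℂ}
    (hU : IsOpen U) {g : ℂ → ℂ} (hg : DifferentiableOn ℂ g U) : g ∈ localClass M U := by
  obtain ⟨p, c, ε, hc, hε, hle⟩ := h.exists_lower_bound hM
  refine ⟨hg, fun K hK hKU => ⟨p, ?_⟩⟩
  obtain ⟨C, ρ, hC, hρ, hb⟩ := exists_iteratedDeriv_bound_of_isCompact hU hg hK hKU
  refine ⟨ρ / ε, by positivity, C / c, fun z hz j => (hb z hz j).trans ?_⟩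
  calc C * (ρ ^ j * (j.factorial : ℝ))
      = C / c * ((ρ / ε) ^ j * (c * ε ^ j * (j.factorial : ℝ))) := by
        rw [div_pow]; field_simp
    _ ≤ _ := by
        have := hle j
        gcongr

/-- Cauchy's estimates place every holomorphic function on U in the local class, so both notions
quantify over the same g. -/
theorem COmega.compositionClosed_iff {M : SeqFamily} (hM : IsWeightMatrix M) (h : COmega M)
    {S : Set ℂ} : CompositionClosed M S ↔ HolomorphicallyClosed M S :=
  ⟨fun hc f hf U hU hUf g hg => hc f hf U hU hUf g (h.mem_localClass hM hU hg),
    fun hh f hf U hU hUf g hg => hh f hf U hU hUf g hg.1⟩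

theorem logConvex_gevreyBar {s c ε : ℝ} (hs : 0 ≤ s) :
    LogConvex fun j => c * ε ^ j * gevreyBar s j := by
  intro j
  have h1 : gevreyBar s (j + 1) ^ 2 ≤ gevreyBar s j * gevreyBar s (j + 2) := by
    simp only [gevreyBar_eq_exp]
    rw [← Real.exp_nat_mul, ← Real.exp_add, Real.exp_le_exp]
    have h2 := Real.convexOn_mul_log.2 (Set.mem_Ici.2 (Nat.cast_nonneg (α := ℝ) j))
      (Set.mem_Ici.2 (Nat.cast_nonneg (α := ℝ) (j + 2)))
      (by norm_num : (0 : ℝ) ≤ 1 / 2) (by norm_num : (0 : ℝ) ≤ 1 / 2) (by norm_num)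
    simp only [smul_eq_mul] at h2
    have h3 : 1 / 2 * (j : ℝ) + 1 / 2 * ((j + 2 : ℕ) : ℝ) = ((j + 1 : ℕ) : ℝ) := by
      push_cast; ring
    rw [h3] at h2
    have h4 := mul_le_mul_of_nonneg_left h2 hs
    push_cast at h4 ⊢
    linarith
  have h5 : 0 ≤ (c * ε ^ (j + 1)) ^ 2 := sq_nonneg _
  calc (c * ε ^ (j + 1) * gevreyBar s (j + 1)) ^ 2
      = (c * ε ^ (j + 1)) ^ 2 * gevreyBar s (j + 1) ^ 2 := by ring
    _ ≤ (c * ε ^ (j + 1)) ^ 2 * (gevreyBar s j * gevreyBar s (j + 2)) := by gcongr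
    _ = _ := by ring

/-- The analytic lower bound survives regularization: c (ε/e)^j j^((2-α)j) is log-convex and lies
below the twisted sequence, so it lies below the minorant. -/
theorem IsRegularizable.exists_check_lower_bound {M : SeqFamily} {α : ℝ}
    (h : IsRegularizable M α) (hω : COmega M) :
    ∃ p, ∃ c ε : ℝ, 0 < c ∧ 0 < ε ∧ ∀ j, c * ε ^ j ≤ check (regularized M α p) j := by
  obtain ⟨p, c, ε, hc, hε, hle⟩ := hω.exists_lower_bound h.weight
  have he := Real.exp_pos 1
  refine ⟨p, c, ε / Real.exp 1, hc, by positivity, fun j => ?_⟩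
  have hpow : ∀ i : ℕ, (i : ℝ) ^ i = gevreyBar 1 i := fun i => by
    rw [gevreyBar, one_mul, Real.rpow_natCast]
  have hs : 0 ≤ 2 - α := by linarith [h.le_one]
  have hmin := le_lcMinorant (N := twisted M α p)
    (L := fun j => c * (ε / Real.exp 1) ^ j * gevreyBar (2 - α) j)
    (fun i => mul_pos (by positivity) (gevreyBar_pos _ _)) (logConvex_gevreyBar hs) (fun i => by
      have h1 := pow_div_exp_le_factorial i
      rw [div_pow, hpow, div_le_iff₀ (by positivity)] at h1
      have h2 : gevreyBar (2 - α) i = gevreyBar (1 - α) i * gevreyBar 1 i := by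
        rw [gevreyBar_mul]; congr 1; ring
      rw [twisted, h2, div_pow]
      have h3 := gevreyBar_pos (1 - α) i
      calc _ = gevreyBar (1 - α) i * (c * ε ^ i * (gevreyBar 1 i / Real.exp 1 ^ i)) := by
            ring
        _ ≤ gevreyBar (1 - α) i * (c * ε ^ i * (i.factorial : ℝ)) := by
            have : gevreyBar 1 i / Real.exp 1 ^ i ≤ (i.factorial : ℝ) :=
              (div_le_iff₀ (by positivity)).2 h1
            gcongr
        _ ≤ _ := by
            have := hle i
            gcongr) j
  have hjf : (0 : ℝ) < j.factorial := by exact_mod_cast j.factorial_pos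
  rw [check, le_div_iff₀ hjf, regularized_eq]
  have h4 : (j.factorial : ℝ) ≤ gevreyBar 1 j := by
    rw [← hpow]; exact_mod_cast Nat.factorial_le_pow j
  have h5 : gevreyBar (α - 1) j * gevreyBar (2 - α) j = gevreyBar 1 j := by
    rw [gevreyBar_mul]; congr 1; ring
  calc _ ≤ c * (ε / Real.exp 1) ^ j * gevreyBar 1 j := by gcongr
    _ = gevreyBar (α - 1) j * (c * (ε / Real.exp 1) ^ j * gevreyBar (2 - α) j) := by
      rw [← h5]; ring
    _ ≤ _ := mul_le_mul_of_nonneg_left hmin (gevreyBar_pos _ _).le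

/-! ### The Faà di Bruno property -/

/-- Derivation closedness lowers each block index by one, saving one factor CX per block; this makes
room for the outer factor, which is at most CX to the number of blocks. -/
theorem IsRegularizable.fdB_of_rai {M : SeqFamily} {α : ℝ} (h : IsRegularizable M α)
    (hdc : Dc (regularized M α)) (hr : Rai (regularized M α)) : FdB (regularized M α) := by
  intro p
  obtain ⟨C₁, hC₁, p₁, hp₁⟩ := hdc p
  obtain ⟨C, hC, q, hq⟩ := hr.check_le_pow h (max p p₁)
  refine ⟨q, 1, C₁ * C, one_pos, by positivity, fun k => ?_⟩
  rcases Nat.eq_zero_or_pos k with rfl | hk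
  · simp [circ, h.check_zero]
  rw [circ, if_neg (by omega)]
  have : Nonempty (Composition k) := ⟨Composition.ones k⟩
  refine ciSup_le fun c => ?_
  obtain ⟨X, hX0, hXk, hXb⟩ := hq k
  have h1 : check (regularized M α p) c.length ≤ (C * X) ^ c.length :=
    (h.check_mono (le_max_left _ _) _).trans (hXb _ c.length_le)
  have h2 : ∀ i, check (regularized M α p) (c.blocksFun i) ≤
      C₁ ^ (c.blocksFun i) * (C * X) ^ (c.blocksFun i - 1) := by
    intro i
    obtain ⟨m, hm⟩ := Nat.exists_eq_add_of_le' (c.one_le_blocksFun i)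
    have hmk : m ≤ k := by have := c.blocksFun_le i; omega
    rw [hm, Nat.add_sub_cancel]
    have h3 := hp₁ m
    have h4 := (h.check_mono (le_max_right p p₁) m).trans (hXb m hmk)
    have h5 : check (regularized M α p) (m + 1) ≤ C₁ ^ (m + 1) * check (regularized M α p₁) m := by
      have hf1 : (0 : ℝ) < m.factorial := by exact_mod_cast m.factorial_pos
      have hf2 : (m.factorial : ℝ) ≤ (m + 1).factorial := by
        exact_mod_cast Nat.factorial_le (Nat.le_succ m)
      have hpos := h.regularized_pos p₁ m
      rw [check, check, ← mul_div_assoc]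
      exact (div_le_div_of_nonneg_right h3 (by positivity)).trans
        (div_le_div_of_nonneg_left (by positivity) hf1 hf2)
    exact h5.trans (by gcongr)
  have h6 : ∏ i : Fin c.length, check (regularized M α p) (c.blocksFun i) ≤
      ∏ i : Fin c.length, C₁ ^ (c.blocksFun i) * (C * X) ^ (c.blocksFun i - 1) :=
    Finset.prod_le_prod (fun i _ => (h.check_pos p _).le) fun i _ => h2 i
  have h7 : (C * X) ^ c.length * ∏ i : Fin c.length, C₁ ^ (c.blocksFun i) *
      (C * X) ^ (c.blocksFun i - 1) = C₁ ^ k * (C * X) ^ k := by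
    have e : (C * X) ^ c.length = ∏ _i : Fin c.length, C * X := by simp
    rw [e, ← Finset.prod_mul_distrib]
    have : ∀ i, C * X * (C₁ ^ (c.blocksFun i) * (C * X) ^ (c.blocksFun i - 1)) =
        (C₁ * (C * X)) ^ (c.blocksFun i) := by
      intro i
      obtain ⟨m, hm⟩ := Nat.exists_eq_add_of_le' (c.one_le_blocksFun i)
      rw [hm, Nat.add_sub_cancel]
      ring
    rw [Finset.prod_congr rfl fun i _ => this i, Finset.prod_pow_eq_pow_sum, c.sum_blocksFun,
      mul_pow]
  calc _ ≤ (C * X) ^ c.length * ∏ i : Fin c.length, C₁ ^ (c.blocksFun i) *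
        (C * X) ^ (c.blocksFun i - 1) :=
        mul_le_mul h1 h6 (Finset.prod_nonneg fun i _ => (h.check_pos p _).le) (by positivity)
    _ = 1 * (C₁ * C) ^ k * X ^ k := by rw [h7, mul_pow, mul_pow]; ring
    _ = _ := by rw [hXk]

theorem mul_pow_le_circ (L : ℕ → ℝ) {j l : ℕ} (hj : 1 ≤ j) (hl : 1 ≤ l) :
    L l * L j ^ l ≤ circ L (l * j) := by
  have hlj : l * j ≠ 0 := (Nat.mul_pos hl hj).ne'
  rw [circ, if_neg hlj]
  let c : Composition (l * j) := ⟨List.replicate l j, fun hi => by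
    rw [List.eq_of_mem_replicate hi]; exact hj, by simp⟩
  have hlen : c.length = l := by simp [c, Composition.length]
  have hblk : ∀ i, c.blocksFun i = j := fun i => by simp [c, Composition.blocksFun]
  have h1 := le_ciSup (f := fun c : Composition (l * j) =>
    L c.length * ∏ i : Fin c.length, L (c.blocksFun i)) (Set.finite_range _).bddAbove c
  refine le_trans (le_of_eq ?_) h1
  simp only [hblk, Finset.prod_const, Finset.card_univ, Fintype.card_fin, hlen]

/-- Test the composition of lj into l equal blocks j. The outer factor is at least c ε^l, so
dividing by it costs only a geometric factor. -/
theorem IsRegularizable.rai_of_fdB {M : SeqFamily} {α : ℝ} (h : IsRegularizable M α)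
    (hω : COmega M) (hF : FdB (regularized M α)) : Rai (regularized M α) := by
  refine h.rai_of_multiples fun p => ?_
  obtain ⟨p₀, c, ε, hc, hε, hlow⟩ := h.exists_check_lower_bound hω
  obtain ⟨q, A, B, hA, hB, hq⟩ := hF (max p p₀)
  set D := max (A / c) 1 with hD
  set E := max ε⁻¹ 1 with hE
  have hD1 : 1 ≤ D := le_max_right _ _
  have hE1 : 1 ≤ E := le_max_right _ _
  refine ⟨D * E * B, by positivity, q, fun j l hj hl => ?_⟩
  have h1 := (mul_pow_le_circ (check (regularized M α (max p p₀))) hj hl).trans (hq (l * j))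
  have h2 := (hlow l).trans (h.check_mono (le_max_right p p₀) l)
  have h3 := pow_le_pow_left₀ (h.check_pos p j).le (h.check_mono (le_max_left p p₀) j) l
  have hp := (h.check_pos p j).le
  have h4 : c * ε ^ l * check (regularized M α p) j ^ l ≤
      A * B ^ (l * j) * check (regularized M α q) (l * j) :=
    (mul_le_mul h2 h3 (by positivity) (h.check_pos _ l).le).trans h1
  have hchk := (h.check_pos q (l * j)).le
  have hlj : l * j ≠ 0 := (Nat.mul_pos hl hj).ne'
  have hljl : l ≤ l * j := Nat.le_mul_of_pos_right l hj
  calc check (regularized M α p) j ^ l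
      = c⁻¹ * ε⁻¹ ^ l * (c * ε ^ l * check (regularized M α p) j ^ l) := by
        rw [inv_pow]; field_simp
    _ ≤ c⁻¹ * ε⁻¹ ^ l * (A * B ^ (l * j) * check (regularized M α q) (l * j)) := by gcongr
    _ = (A / c) * ε⁻¹ ^ l * B ^ (l * j) * check (regularized M α q) (l * j) := by ring
    _ ≤ D ^ (l * j) * E ^ (l * j) * B ^ (l * j) * check (regularized M α q) (l * j) := by
        have hd : A / c ≤ D ^ (l * j) := (le_max_left _ _).trans (le_self_pow₀ hD1 hlj)
        have he : ε⁻¹ ^ l ≤ E ^ (l * j) :=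
          (pow_le_pow_left₀ (by positivity) (le_max_left _ _) l).trans
            (pow_le_pow_right₀ hE1 hljl)
        gcongr
    _ = _ := by rw [mul_pow, mul_pow]

end Ultraholomorphic

theorem mainTheorem1 (M : SeqFamily) (hM : IsWeightMatrix M) (α : ℝ) (hα0 : 0 < α) (hα1 : α ≤ 1)
    (hlim : ∀ p, Tendsto (fun j : ℕ => (gevreyBar (1 - α) j * M p j) ^ (1 / (j : ℝ))) atTop atTop) :
    [Rai (regularized M α),
      HolomorphicallyClosed M (sector α),
      InverseClosed M (sector α)].TFAE ∧
    (COmega M → Dc (regularized M α) →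
      [Rai (regularized M α),
        HolomorphicallyClosed M (sector α),
        InverseClosed M (sector α),
        CompositionClosed M (sector α),
        FdB (regularized M α)].TFAE) := by
  have h : IsRegularizable M α := ⟨hM, hα0, hα1, hlim⟩
  refine ⟨?_, fun hω hdc => ?_⟩
  · tfae_have 1 → 2 := h.holomorphicallyClosed_of_rai
    tfae_have 2 → 3 := HolomorphicallyClosed.inverseClosed
    tfae_have 3 → 1 := h.rai_of_inverseClosed
    tfae_finish
  · tfae_have 1 → 2 := h.holomorphicallyClosed_of_rai
    tfae_have 2 → 3 := HolomorphicallyClosed.inverseClosed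
    tfae_have 3 → 1 := h.rai_of_inverseClosed
    tfae_have 4 ↔ 2 := hω.compositionClosed_iff hM
    tfae_have 1 → 5 := h.fdB_of_rai hdc
    tfae_have 5 → 1 := h.rai_of_fdB hω
    tfae_finish
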